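/- Let $n\ge k\ge 0$ be integers and let $\Omega$ be a symmetric complex $n\times n$ matrix whose imaginary part $\operatorname{Im}\Omega$ is non-degenerate and has exactly $k$ negative eigenvalues (counted with multiplicity); thus $X_\Omega=\mathbb C^n/(\Omega\mathbb Z^n\oplus\mathbb Z^n)$ is a principally polarized complex torus of index $k$. Let $F$ be the space of entire functions on $\mathbb C^n$, with the action of $\Lambda=\Lambda_1\oplus\Lambda_2$, $\Lambda_1=\Lambda_2=\mathbb Z^n$, in which $N\in\Lambda_1$ and $M\in\Lambda_2$ act together by $$ (M,N)\cdot f(Z)=e^{2\pi i\,{}^tNZ}\,e^{\pi i\,{}^tN\Omega N}f(Z+M+\Omega N). $$ Let $N_1,\dots,N_n$ be a basis of $\Lambda_1$ and $M_1,\dots,M_n$ a basis of $\Lambda_2$ which are split with respect to $\operatorname{Im}\Omega$: the quadratic form $\operatorname{Im}\Omega$ is positive definite on the real span of $N_{k+1},\dots,N_n$, and $(\operatorname{Im}\Omega)^{-1}$ is positive definite on the real span of $M_{k+1},\dots,M_n$. Put $\Gamma_+=\mathbb Z\langle N_{k+1},\dots,N_n\rangle$ and, for $K\in\mathbb Z^n$,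 $\Theta_K(Z,\Omega)=e^{\pi i\,{}^tK\Omega K}e^{2\pi i\,{}^tKZ}$. Let $\mathcal C$ be the $2n$-tuple Koszul complex with a term $\mathcal C_{J;I}=F$ for each pair of subsets $J,I\subseteq\{1,\dots,n\}$, in total degree $|J|+|I|$, and with differentials $\delta_j=N_j-1$ (adding $j$ to $J$) and $d_i=M_i-1$ (adding $i$ to $I$), combined with the usual Koszul signs for the ordering $N_1,\dots,N_n,M_1,\dots,M_n$ of the directions into a total differential. Then the cohomology of the total complex satisfies $$H^i(\mathcal C)=0\ \text{ for } i\neq k,\qquad H^k(\mathcal C)\cong\mathbb C.$$ Moreover the series $\sum_{K\in\Gamma_+}\Theta_K(Z,\Omega)$ converges absolutely for every $Z$ to an entire function, and the cochain $c$ equal to $\sum_{K\in\Gamma_+}\Theta_K(Z,\Omega)$ in the term $\mathcal C_{\{1,\dots,k\};\emptyset}$ and to $0$ in all other terms is a cocycle whose class spans $H^k(\mathcal C)$. -/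

import Mathlib

open scoped Matrix

noncomputable section

namespace ThetaForms

/-! ### The Koszul cochain complex of a family of operators -/

section Koszul

variable {ι : Type*} [LinearOrder ι] {A : Type*} [AddCommGroup A] [Module ℂ A]

/-- The total differential of the multiple complex which has one copy of `A` for each subset
`S` of `ι` (in total degree `#S`) and the operator `D p` in the direction `p`:
`(d f)(S) = ∑_{p ∈ S} (-1)^{#{q ∈ S : q < p}} D_p (f (S \ {p}))`. -/
def koszulD (D : ι → A →ₗ[ℂ] A) : (Finset ι → A) →ₗ[ℂ] (Finset ι → A) where
  toFun f S := ∑ p ∈ S, (-1 : ℂ) ^ (S.filter (· < p)).card • D p (f (S.erase p))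
  map_add' f g := by
    funext S
    simp [Finset.sum_add_distrib]
  map_smul' c f := by
    funext S
    simp only [Pi.smul_apply, map_smul, RingHom.id_apply, Finset.smul_sum]
    exact Finset.sum_congr rfl fun p _ => smul_comm _ _ _

variable (ι A) in
/-- The cochains of total degree `i`: the families living in the terms indexed by subsets with
`i` elements. -/
def koszulCochains (i : ℤ) : Submodule ℂ (Finset ι → A) where
  carrier := {f | ∀ S : Finset ι, (S.card : ℤ) ≠ i → f S = 0}
  add_mem' hf hg S hS := by simp [hf S hS, hg S hS]
  zero_mem' _ _ := rfl
  smul_mem' c f hf S hS := by simp [hf S hS]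

/-- The cocycles of degree `i`. -/
def koszulCocycles (D : ι → A →ₗ[ℂ] A) (i : ℤ) : Submodule ℂ (Finset ι → A) :=
  koszulCochains ι A i ⊓ LinearMap.ker (koszulD D)

/-- The coboundaries of degree `i`. -/
def koszulCoboundaries (D : ι → A →ₗ[ℂ] A) (i : ℤ) : Submodule ℂ (Finset ι → A) :=
  (koszulCochains ι A (i - 1)).map (koszulD D)

/-- The cohomology of the total complex in degree `i`: cocycles modulo coboundaries. -/
abbrev KoszulCohomology (D : ι → A →ₗ[ℂ] A) (i : ℤ) : Type _ :=
  koszulCocycles D i ⧸ (koszulCoboundaries D i).submoduleOf (koszulCocycles D i)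

theorem koszulD_sign {S : Finset ι} {p q : ι} (hq : q ∈ S) (hlt : q < p) :
    (-1 : ℂ) ^ (S.filter (· < p)).card * (-1 : ℂ) ^ ((S.erase p).filter (· < q)).card =
      -((-1 : ℂ) ^ (S.filter (· < q)).card * (-1 : ℂ) ^ ((S.erase q).filter (· < p)).card) := by
  have h1 : (S.erase p).filter (· < q) = S.filter (· < q) := by
    ext x
    simp only [Finset.mem_filter, Finset.mem_erase]
    exact ⟨fun h => ⟨h.1.2, h.2⟩, fun h => ⟨⟨(h.2.trans hlt).ne, h.1⟩, h.2⟩⟩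
  have h2 : (S.erase q).filter (· < p) = (S.filter (· < p)).erase q := by
    ext x
    simp only [Finset.mem_filter, Finset.mem_erase]
    tauto
  have h3 : q ∈ S.filter (· < p) := by simp [hq, hlt]
  rw [h1, h2, ← Finset.card_erase_add_one h3, pow_succ]
  ring

/-- If the operators commute, the total differential squares to zero. -/
theorem koszulD_koszulD (D : ι → A →ₗ[ℂ] A) (hD : ∀ p q a, D p (D q a) = D q (D p a))
    (f : Finset ι → A) : koszulD D (koszulD D f) = 0 := by
  funext S
  simp only [koszulD, LinearMap.coe_mk, AddHom.coe_mk, map_sum, map_smul, Finset.smul_sum,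
    smul_smul, Pi.zero_apply]
  rw [Finset.sum_sigma']
  refine Finset.sum_involution (fun x _ => ⟨x.2, x.1⟩) ?_ ?_ ?_ ?_
  · rintro ⟨p, q⟩ h
    simp only [Finset.mem_sigma, Finset.mem_erase] at h
    obtain ⟨hp, hqp, hq⟩ := h
    dsimp only
    rw [hD q p, Finset.erase_right_comm (a := q)]
    rcases lt_or_gt_of_ne hqp with hlt | hlt
    · rw [koszulD_sign hq hlt, neg_smul, neg_add_cancel]
    · rw [koszulD_sign hp hlt, neg_smul, add_neg_cancel]
  · rintro ⟨p, q⟩ h _ he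
    simp only [Finset.mem_sigma, Finset.mem_erase] at h
    simp only [Sigma.mk.injEq] at he
    exact h.2.1 he.1
  · rintro ⟨p, q⟩ h
    simp only [Finset.mem_sigma, Finset.mem_erase] at h ⊢
    exact ⟨h.2.2, h.2.1.symm, h.1⟩
  · rintro ⟨p, q⟩ h
    rfl

/-- The total differential raises the degree by one. -/
theorem koszulD_mem (D : ι → A →ₗ[ℂ] A) {i : ℤ} {f : Finset ι → A}
    (hf : f ∈ koszulCochains ι A i) : koszulD D f ∈ koszulCochains ι A (i + 1) := by
  intro S hS
  refine Finset.sum_eq_zero fun p hp => ?_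
  have h : f (S.erase p) = 0 := by
    refine hf _ fun h => hS ?_
    rw [← h, ← Finset.card_erase_add_one hp]
    push_cast
    ring
  rw [h, map_zero, smul_zero]

/-- Coboundaries of commuting operators are cocycles. -/
theorem koszulCoboundaries_le (D : ι → A →ₗ[ℂ] A) (hD : ∀ p q a, D p (D q a) = D q (D p a))
    (i : ℤ) : koszulCoboundaries D i ≤ koszulCocycles D i := by
  rintro _ ⟨f, hf, rfl⟩
  exact ⟨by simpa using koszulD_mem D hf, koszulD_koszulD D hD f⟩

end Koszul

/-! ### Entire functions and the lattice action -/

/-- The space `F` of entire functions on `ℂⁿ`. -/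
def Entire (n : ℕ) : Submodule ℂ ((Fin n → ℂ) → ℂ) where
  carrier := {f | Differentiable ℂ f}
  add_mem' hf hg := Differentiable.add hf hg
  zero_mem' := differentiable_const 0
  smul_mem' c _ hf := Differentiable.const_smul hf c

variable {n : ℕ}

/-- An integral vector regarded as a complex one. -/
def toC (v : Fin n → ℤ) : Fin n → ℂ := fun j => (v j : ℂ)

/-- An integral vector regarded as a real one. -/
def toR (v : Fin n → ℤ) : Fin n → ℝ := fun j => (v j : ℝ)

/-- The operator `(M, N)` of the action of `Λ = ℤⁿ ⊕ ℤⁿ` on entire functions: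
`f(Z) ↦ exp(2πi ᵗN Z) exp(πi ᵗN Ω N) f(Z + M + Ω N)`. -/
def latticeAct (Ω : Matrix (Fin n) (Fin n) ℂ) (M N : Fin n → ℤ) :
    Entire n →ₗ[ℂ] Entire n where
  toFun f := ⟨fun Z =>
      Complex.exp (2 * Real.pi * Complex.I * (toC N ⬝ᵥ Z)) *
        Complex.exp (Real.pi * Complex.I * (toC N ⬝ᵥ Ω *ᵥ toC N)) *
        f.1 (Z + toC M + Ω *ᵥ toC N), by
    have hf : Differentiable ℂ f.1 := f.2
    have h1 : Differentiable ℂ fun Z : Fin n → ℂ => f.1 (Z + toC M + Ω *ᵥ toC N) :=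
      hf.comp (by fun_prop)
    have h2 : Differentiable ℂ fun Z : Fin n → ℂ => toC N ⬝ᵥ Z := by
      unfold dotProduct
      fun_prop
    exact ((((h2.const_mul _).cexp).mul_const _).mul h1)⟩
  map_add' f g := by
    ext Z
    simp [mul_add]
  map_smul' c f := by
    ext Z
    simp only [Submodule.coe_smul, Pi.smul_apply, smul_eq_mul, RingHom.id_apply]
    ring

/-- For symmetric `Ω` these operators form an action of the lattice. -/
theorem latticeAct_latticeAct {Ω : Matrix (Fin n) (Fin n) ℂ} (hΩ : Ω.IsSymm)
    (M N M' N' : Fin n → ℤ) (f : Entire n) :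
    latticeAct Ω M N (latticeAct Ω M' N' f) = latticeAct Ω (M + M') (N + N') f := by
  ext Z
  have hadd : ∀ v w : Fin n → ℤ, toC (v + w) = toC v + toC w := fun v w => by
    funext j; simp [toC]
  have hsymm : toC N ⬝ᵥ Ω *ᵥ toC N' = toC N' ⬝ᵥ Ω *ᵥ toC N := by
    rw [Matrix.dotProduct_mulVec, ← Matrix.mulVec_transpose, hΩ.eq, dotProduct_comm]
  have hint : toC N' ⬝ᵥ toC M = ((N' ⬝ᵥ M : ℤ) : ℂ) := by
    simp [toC, dotProduct]
  have hexp : Complex.exp (2 * Real.pi * Complex.I * (toC N' ⬝ᵥ toC M)) = 1 := by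
    rw [hint, mul_comm]
    exact Complex.exp_int_mul_two_pi_mul_I _
  simp only [latticeAct, LinearMap.coe_mk, AddHom.coe_mk, hadd, Matrix.mulVec_add,
    dotProduct_add, add_dotProduct, hsymm]
  have harg : Z + toC M + Ω *ᵥ toC N + toC M' + Ω *ᵥ toC N' =
      Z + (toC M + toC M') + (Ω *ᵥ toC N + Ω *ᵥ toC N') := by abel
  rw [harg, ← mul_assoc]
  congr 1
  simp only [mul_add, Complex.exp_add, hexp]
  rw [show 2 * (Real.pi : ℂ) * Complex.I * (toC N' ⬝ᵥ Ω *ᵥ toC N) =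
    Real.pi * Complex.I * (toC N' ⬝ᵥ Ω *ᵥ toC N) +
      Real.pi * Complex.I * (toC N' ⬝ᵥ Ω *ᵥ toC N) by ring, Complex.exp_add]
  ring

/-- The functions `Θ_K(Z, Ω) = exp(πi ᵗK Ω K) exp(2πi ᵗK Z)`. -/
def Theta (Ω : Matrix (Fin n) (Fin n) ℂ) (K : Fin n → ℤ) (Z : Fin n → ℂ) : ℂ :=
  Complex.exp (Real.pi * Complex.I * (toC K ⬝ᵥ Ω *ᵥ toC K)) *
    Complex.exp (2 * Real.pi * Complex.I * (toC K ⬝ᵥ Z))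

/-! ### Period matrices of index `k` and split bases -/

/-- The imaginary part of a complex matrix. -/
def imPart (Ω : Matrix (Fin n) (Fin n) ℂ) : Matrix (Fin n) (Fin n) ℝ := Ω.map Complex.im

theorem imPart_isHermitian {Ω : Matrix (Fin n) (Fin n) ℂ} (hΩ : Ω.IsSymm) :
    (imPart Ω).IsHermitian := by
  ext i j
  simp [imPart, hΩ.apply i j]

/-- `Ω` is a symmetric complex matrix whose imaginary part is non-degenerate and has exactly `k`
negative eigenvalues, counted with multiplicity. -/
structure IsPeriodMatrix (k : ℕ) (Ω : Matrix (Fin n) (Fin n) ℂ) : Prop where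
  symm : Ω.IsSymm
  nondegenerate : (imPart Ω).det ≠ 0
  index : (Finset.univ.filter fun i => (imPart_isHermitian symm).eigenvalues i < 0).card = k

/-- The quadratic form `x ↦ ᵗx Q x` is positive definite on the real span of the vectors
`B_{k+1}, …, B_n` (in the numbering from `1`). -/
def PosDefOnTail (k : ℕ) (Q : Matrix (Fin n) (Fin n) ℝ)
    (B : Module.Basis (Fin n) ℤ (Fin n → ℤ)) : Prop :=
  ∀ x ∈ Submodule.span ℝ ((fun j => toR (B j)) '' {j : Fin n | k ≤ (j : ℕ)}),
    x ≠ 0 → 0 < x ⬝ᵥ Q *ᵥ x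

/-- The basis `{N_1, …, N_n, M_1, …, M_n}` of `Λ = Λ₁ ⊕ Λ₂` is split with respect to `Q`:
`Q` is positive definite on `⟨N_{k+1}, …, N_n⟩` and `Q⁻¹` on `⟨M_{k+1}, …, M_n⟩`. -/
structure IsSplit (k : ℕ) (Q : Matrix (Fin n) (Fin n) ℝ)
    (N M : Module.Basis (Fin n) ℤ (Fin n → ℤ)) : Prop where
  pos_left : PosDefOnTail k Q N
  pos_right : PosDefOnTail k Q⁻¹ M

/-- The sublattice `Γ₊` of `Λ₁` spanned by `N_{k+1}, …, N_n`. -/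
def GammaPlus (k : ℕ) (N : Module.Basis (Fin n) ℤ (Fin n → ℤ)) : Submodule ℤ (Fin n → ℤ) :=
  Submodule.span ℤ (N '' {j : Fin n | k ≤ (j : ℕ)})

/-! ### The `2n`-tuple complex -/

/-- The `2n` directions, in the order `u_1 < ⋯ < u_n < v_1 < ⋯ < v_n`, where `u_j` belongs to
`N_j` and `v_i` to `M_i`. -/
abbrev Dir (n : ℕ) : Type := Fin n ⊕ₗ Fin n

/-- The differentials of the `2n`-tuple complex: `δ_j = N_j - 1` in the direction `u_j` and
`d_i = M_i - 1` in the direction `v_i`. -/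
def diff (Ω : Matrix (Fin n) (Fin n) ℂ) (N M : Module.Basis (Fin n) ℤ (Fin n → ℤ))
    (p : Dir n) : Entire n →ₗ[ℂ] Entire n :=
  match ofLex p with
  | Sum.inl j => latticeAct Ω 0 (N j) - LinearMap.id
  | Sum.inr i => latticeAct Ω (M i) 0 - LinearMap.id

/-- The differentials in different directions commute. -/
theorem diff_comm {Ω : Matrix (Fin n) (Fin n) ℂ} (hΩ : Ω.IsSymm)
    (N M : Module.Basis (Fin n) ℤ (Fin n → ℤ)) (p q : Dir n) (f : Entire n) :
    diff Ω N M p (diff Ω N M q f) = diff Ω N M q (diff Ω N M p f) := by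
  have key : ∀ a b a' b' : Fin n → ℤ,
      (latticeAct Ω a b - (LinearMap.id : Entire n →ₗ[ℂ] Entire n))
          ((latticeAct Ω a' b' - (LinearMap.id : Entire n →ₗ[ℂ] Entire n)) f) =
        (latticeAct Ω a' b' - (LinearMap.id : Entire n →ₗ[ℂ] Entire n))
          ((latticeAct Ω a b - (LinearMap.id : Entire n →ₗ[ℂ] Entire n)) f) := by
    intro a b a' b'
    simp only [LinearMap.sub_apply, LinearMap.id_apply, map_sub, latticeAct_latticeAct hΩ]
    rw [add_comm a', add_comm b']
    abel
  unfold diff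
  rcases ofLex p with j | i <;> rcases ofLex q with j' | i' <;> exact key _ _ _ _

/-- The index of the term `C_{1,…,k;∅}`: the directions `u_1, …, u_k`. -/
def topIndex (n k : ℕ) : Finset (Dir n) :=
  Finset.univ.filter fun p => ∃ j : Fin n, (j : ℕ) < k ∧ p = Sum.inlₗ j

/-- The cochain with value `θ` in the term `C_{1,…,k;∅}` and `0` in all other terms. -/
def cochainAt (k : ℕ) (θ : Entire n) : Finset (Dir n) → Entire n :=
  Pi.single (topIndex n k) θ

end ThetaForms

end

/-!
The translations `M_i` and the operators `N_j` are eliminated from the Koszul complex one at a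
time, always in the largest remaining direction. An operator which is surjective may be dropped if
the module is replaced by its kernel (`KoszulLine.of_surjective`); an operator which is injective
may be dropped if the module is replaced by its cokernel, and then the degree goes up by one
(`KoszulLine.of_injective`). The invariant which is followed through the elimination is
`KoszulLine`: the total cohomology is a line, spanned by the class of an explicit cochain
concentrated at one subset of directions.

*The directions `M_i`.* The operator `M_i - 1` is surjective on the entire functions with periods
`M_{i+1}, …, M_n`: this is the difference equation `f (Z + v) - f Z = g Z`, solved in
`exists_entire_translate_sub_eq` by expanding `g` into powers of the coordinate along `v` and using
solutions for the monomials which grow only geometrically with the exponent. So these directions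
contribute nothing, and the functions with all periods `M_i` remain
(`KoszulLine.of_tailPeriodic`).

*Coefficients.* A periodic entire function is a series `∑ a_x Θ_{N x}`, and the coefficients which
occur are those with `a_x = O(exp (π Q(x) - R |x|))` for every `R`, where `Q` is the form `Im Ω` in
the coordinates of the basis `N` (`thetaSeries_injective`, `thetaSeries_surjective`). The decay
comes from shifting the contour of integration in the Fourier coefficients. The operator `N_j`
translates the coefficients by the `j`-th unit vector.

*The directions `N_j`.* Complete the square in the last variable:
`Q(x, t) = g (t + l x) ^ 2 + Q'(x)`. The hypotheses on the basis and on the signature say that `g`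
is positive for the last `n - k` variables and negative for the first `k` ones
(`IsSplitForm.exists_schur`, `neg_of_orthogonal`). If `g` is positive, the coefficients may grow
along the lines in the last direction; the difference operator is surjective, by summation starting
at the vertex of the parabola, and its kernel consists of the coefficients for `Q'`. If `g` is
negative, the coefficients decay along these lines; the difference operator is injective, and its
cokernel is identified with the coefficients for `Q'` by summation over the lines. In both cases
the bounds come from `kernel_sum_bound`. After all variables are eliminated a line is left, in
degree `k`, and the generator comes from the indicator function of the vectors whose first `k`
coordinates vanish, that is, from the theta series over `Γ₊`.
-/

noncomputable section

namespace ThetaForms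

/-! ### Elimination of one direction from a Koszul complex -/

section KoszulElimination

variable {ι : Type*} [LinearOrder ι] {A A' : Type*} [AddCommGroup A] [Module ℂ A]
  [AddCommGroup A'] [Module ℂ A']

theorem koszulD_apply (D : ι → A →ₗ[ℂ] A) (f : Finset ι → A) (S : Finset ι) :
    koszulD D f S = ∑ p ∈ S, (-1 : ℂ) ^ (S.filter (· < p)).card • D p (f (S.erase p)) := rfl

theorem koszulD_congr (D : ι → A →ₗ[ℂ] A) {f g : Finset ι → A} {S : Finset ι}
    (h : ∀ S' ⊆ S, f S' = g S') : koszulD D f S = koszulD D g S := by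
  simp only [koszulD_apply]
  exact Finset.sum_congr rfl fun p _ => by rw [h _ (Finset.erase_subset _ _)]

theorem koszulD_map {D : ι → A →ₗ[ℂ] A} {D' : ι → A' →ₗ[ℂ] A'} (φ : A' →ₗ[ℂ] A)
    {S : Finset ι} (hφ : ∀ q ∈ S, ∀ a, D q (φ a) = φ (D' q a)) (f : Finset ι → A') :
    koszulD D (fun S => φ (f S)) S = φ (koszulD D' f S) := by
  simp only [koszulD_apply, map_sum, map_smul]
  exact Finset.sum_congr rfl fun p hp => by rw [hφ p hp]

/-- The total differential at a subset with largest element `p`. -/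
theorem koszulD_insert (D : ι → A →ₗ[ℂ] A) (f : Finset ι → A) {S : Finset ι} {p : ι}
    (hp : ∀ q ∈ S, q < p) :
    koszulD D f (insert p S) =
      koszulD D (fun S => f (insert p S)) S + (-1 : ℂ) ^ S.card • D p (f S) := by
  have hpS : p ∉ S := fun h => lt_irrefl _ (hp p h)
  simp only [koszulD_apply]
  rw [Finset.sum_insert hpS, add_comm]
  congr 1
  · refine Finset.sum_congr rfl fun q hq => ?_
    have h1 : (insert p S).filter (· < q) = S.filter (· < q) := by
      rw [Finset.filter_insert, if_neg (hp q hq).not_gt]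
    rw [h1, Finset.erase_insert_of_ne (hp q hq).ne']
  · have h1 : (insert p S).filter (· < p) = S := by
      rw [Finset.filter_insert, if_neg (lt_irrefl _), Finset.filter_true_of_mem hp]
    rw [h1, Finset.erase_insert hpS]

/-- The cochain which is `f₀` on the subsets without `p` and `f₁` on the subsets with `p`. -/
def koszulGlue {B : Type*} (p : ι) (f₀ f₁ : Finset ι → B) (S : Finset ι) : B :=
  if p ∈ S then f₁ (S.erase p) else f₀ S

theorem koszulGlue_of_notMem {B : Type*} {p : ι} {S : Finset ι} (f₀ f₁ : Finset ι → B)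
    (h : p ∉ S) : koszulGlue p f₀ f₁ S = f₀ S := if_neg h

theorem koszulGlue_insert {B : Type*} {p : ι} {S : Finset ι} (f₀ f₁ : Finset ι → B) (h : p ∉ S) :
    koszulGlue p f₀ f₁ (insert p S) = f₁ S := by
  simp [koszulGlue, h]

theorem koszulD_glue_of_lt (D : ι → A →ₗ[ℂ] A) (f₀ f₁ : Finset ι → A) {S : Finset ι} {p : ι}
    (hp : ∀ q ∈ S, q < p) : koszulD D (koszulGlue p f₀ f₁) S = koszulD D f₀ S :=
  koszulD_congr D fun _ hS' => koszulGlue_of_notMem _ _ fun h => lt_irrefl _ (hp p (hS' h))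

theorem koszulD_glue_insert (D : ι → A →ₗ[ℂ] A) (f₀ f₁ : Finset ι → A) {S : Finset ι} {p : ι}
    (hp : ∀ q ∈ S, q < p) :
    koszulD D (koszulGlue p f₀ f₁) (insert p S) =
      koszulD D f₁ S + (-1 : ℂ) ^ S.card • D p (f₀ S) := by
  have hpS : p ∉ S := fun h => lt_irrefl _ (hp p h)
  rw [koszulD_insert D _ hp, koszulGlue_of_notMem _ _ hpS]
  congr 1
  exact koszulD_congr D fun _ hS' => koszulGlue_insert _ _ fun h => hpS (hS' h)

/-- Every subset of `insert p T` is a subset of `T`, possibly with `p` adjoined. -/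
theorem forall_subset_insert {p : ι} {T : Finset ι} {P : Finset ι → Prop}
    (h₀ : ∀ S ⊆ T, P S) (h₁ : ∀ S ⊆ T, P (insert p S)) : ∀ S ⊆ insert p T, P S := by
  intro S hS
  by_cases hp : p ∈ S
  · rw [← Finset.insert_erase hp]
    exact h₁ _ (Finset.subset_insert_iff.1 hS)
  · exact h₀ _ ((Finset.subset_insert_iff_of_notMem hp).1 hS)

/-- The Koszul cohomology of the operators `D q`, `q ∈ T`, is a line, spanned by the class of the
cochain with value `a` at `S₀` and `0` elsewhere. Cochains are functions on all finite sets of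
directions of which only the values at subsets of `T` matter. No grading is mentioned: cocycles
and cochains are sums of homogeneous ones. -/
structure KoszulLine (D : ι → A →ₗ[ℂ] A) (T S₀ : Finset ι) (a : A) : Prop where
  spans : ∀ f : Finset ι → A, (∀ S ⊆ T, koszulD D f S = 0) →
    ∃ (c : ℂ) (g : Finset ι → A), ∀ S ⊆ T,
      f S = c • (Pi.single S₀ a : Finset ι → A) S + koszulD D g S
  nontrivial : ¬ ∃ g : Finset ι → A, ∀ S ⊆ T, (Pi.single S₀ a : Finset ι → A) S = koszulD D g S

theorem sign_smul_sign_smul (n : ℕ) (a : A) :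
    (-1 : ℂ) ^ n • ((-1 : ℂ) ^ n • a) = a := by
  rw [smul_smul, ← pow_add, Even.neg_one_pow ⟨n, rfl⟩, one_smul]

theorem map_single_apply (φ : A' →ₗ[ℂ] A) (S₀ S : Finset ι) (a : A') :
    φ ((Pi.single S₀ a : Finset ι → A') S) = (Pi.single S₀ (φ a) : Finset ι → A) S := by
  by_cases h : S = S₀
  · subst h; simp
  · simp [h]

/-- A commuting operator, twisted by the sign of the degree, anticommutes with the differential. -/
theorem koszulD_sign_smul (D : ι → A →ₗ[ℂ] A) (hD : ∀ p q a, D p (D q a) = D q (D p a)) (p : ι)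
    (h : Finset ι → A) (S : Finset ι) :
    koszulD D (fun S => (-1 : ℂ) ^ S.card • D p (h S)) S =
      -((-1 : ℂ) ^ S.card • D p (koszulD D h S)) := by
  simp only [koszulD_apply, map_sum, map_smul, Finset.smul_sum, ← Finset.sum_neg_distrib]
  refine Finset.sum_congr rfl fun q hq => ?_
  rw [hD p q, ← Finset.card_erase_add_one hq, pow_succ, smul_smul, smul_smul, ← neg_smul]
  congr 1
  ring

/-- Elimination of a surjective operator in the largest direction: the cohomology is that of the
remaining operators on its kernel. -/
theorem KoszulLine.of_surjective {D : ι → A →ₗ[ℂ] A} {D' : ι → A' →ₗ[ℂ] A'}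
    (hD : ∀ p q a, D p (D q a) = D q (D p a)) (φ : A' →ₗ[ℂ] A) {T S₀ : Finset ι} {p : ι}
    (hp : ∀ q ∈ T, q < p) (hS₀ : S₀ ⊆ T) (hφ : ∀ q ∈ T, ∀ a, D q (φ a) = φ (D' q a))
    (hinj : Function.Injective φ) (hker : ∀ a, D p a = 0 → ∃ a', φ a' = a)
    (hker' : ∀ a', D p (φ a') = 0)
    (hsurj : Function.Surjective (D p)) {a : A'} (h : KoszulLine D' T S₀ a) :
    KoszulLine D (insert p T) S₀ (φ a) := by
  have hlt : ∀ S ⊆ T, ∀ q ∈ S, q < p := fun S hS q hq => hp q (hS hq)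
  have hpT : ∀ S ⊆ T, p ∉ S := fun S hS h => lt_irrefl _ (hp p (hS h))
  have hsingle : ∀ S ⊆ T, (Pi.single S₀ (φ a) : Finset ι → A) (insert p S) = 0 := fun S _ => by
    refine Pi.single_eq_of_ne (fun h => hpT S₀ hS₀ ?_) _
    rw [← h]; exact Finset.mem_insert_self _ _
  choose r hr using hsurj
  refine ⟨fun f hf => ?_, ?_⟩
  · -- `h₀` kills the components of `f` in the direction `p`
    let h₀ : Finset ι → A := fun S => (-1 : ℂ) ^ S.card • r (f (insert p S))
    have hh₀ : ∀ S, (-1 : ℂ) ^ S.card • D p (h₀ S) = f (insert p S) := fun S => by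
      simp only [h₀, map_smul, hr, sign_smul_sign_smul]
    have hk : ∀ S ⊆ T, D p (f S - koszulD D h₀ S) = 0 := by
      intro S hS
      have h1 := hf _ (Finset.insert_subset_insert p hS)
      rw [koszulD_insert D f (hlt S hS)] at h1
      have h2 := koszulD_sign_smul D hD p h₀ S
      simp only [hh₀] at h2
      rw [h2, ← sub_eq_neg_add, ← smul_sub, ← map_sub] at h1
      simpa using h1
    have hex : ∀ S : Finset ι, ∃ a', S ⊆ T → φ a' = f S - koszulD D h₀ S := fun S => by
      by_cases hS : S ⊆ T
      · obtain ⟨a', ha'⟩ := hker _ (hk S hS)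
        exact ⟨a', fun _ => ha'⟩
      · exact ⟨0, fun h => absurd h hS⟩
    choose f' hf' using hex
    have hcoc : ∀ S ⊆ T, koszulD D' f' S = 0 := by
      intro S hS
      apply hinj
      rw [map_zero, ← koszulD_map (D := D) φ fun q hq => hφ q (hS hq),
        koszulD_congr D (g := f - koszulD D h₀) fun S' hS' => hf' S' (hS'.trans hS), map_sub,
        koszulD_koszulD D hD]
      simpa using hf S (hS.trans (Finset.subset_insert _ _))
    obtain ⟨c, g, hg⟩ := h.spans f' hcoc
    refine ⟨c, koszulGlue p (fun S => φ (g S) + h₀ S) 0, forall_subset_insert ?_ ?_⟩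
    · intro S hS
      rw [koszulD_glue_of_lt D _ _ (hlt S hS)]
      change _ = _ + koszulD D ((fun S => φ (g S)) + h₀) S
      rw [map_add, Pi.add_apply, koszulD_map (D' := D') φ fun q hq => hφ q (hS hq), ← add_assoc,
        ← map_single_apply, ← map_smul, ← map_add, ← hg S hS, hf' S hS, sub_add_cancel]
    · intro S hS
      rw [koszulD_glue_insert D _ _ (hlt S hS), hsingle S hS]
      simp only [map_add, hker', zero_add, hh₀, smul_zero, map_zero, Pi.zero_apply]
  · rintro ⟨g, hg⟩
    refine h.nontrivial ?_
    let h₀ : Finset ι → A := fun S => (-1 : ℂ) ^ S.card • r (g (insert p S))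
    have hh₀ : ∀ S, (-1 : ℂ) ^ S.card • D p (h₀ S) = g (insert p S) := fun S => by
      simp only [h₀, map_smul, hr, sign_smul_sign_smul]
    have hk : ∀ S ⊆ T, D p (g S - koszulD D h₀ S) = 0 := by
      intro S hS
      have h1 := hg _ (Finset.insert_subset_insert p hS)
      rw [hsingle S hS, koszulD_insert D g (hlt S hS)] at h1
      have h2 := koszulD_sign_smul D hD p h₀ S
      simp only [hh₀] at h2
      rw [h2, ← sub_eq_neg_add, ← smul_sub, ← map_sub] at h1
      simpa using h1.symm
    have hex : ∀ S : Finset ι, ∃ a', S ⊆ T → φ a' = g S - koszulD D h₀ S := fun S => by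
      by_cases hS : S ⊆ T
      · obtain ⟨a', ha'⟩ := hker _ (hk S hS)
        exact ⟨a', fun _ => ha'⟩
      · exact ⟨0, fun h => absurd h hS⟩
    choose g' hg' using hex
    refine ⟨g', fun S hS => hinj ?_⟩
    rw [map_single_apply, hg S (hS.trans (Finset.subset_insert _ _)),
      ← koszulD_map (D := D) φ fun q hq => hφ q (hS hq),
      koszulD_congr D (f := fun S => φ (g' S)) (g := g - koszulD D h₀)
        fun S' hS' => hg' S' (hS'.trans hS), map_sub, koszulD_koszulD D hD, sub_zero]

/-- Elimination of an injective operator in the largest direction: the cohomology is that of the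
remaining operators on its cokernel, with the degree raised by one. Only classes in the top degree
are considered, for which the cocycle condition is empty. -/
theorem KoszulLine.of_injective {D : ι → A →ₗ[ℂ] A} {D' : ι → A' →ₗ[ℂ] A'}
    (hD : ∀ p q a, D p (D q a) = D q (D p a)) (π : A →ₗ[ℂ] A') {T : Finset ι} {p : ι}
    (hp : ∀ q ∈ T, q < p) (hπ : ∀ q ∈ T, ∀ a, D' q (π a) = π (D q a))
    (hsurj : Function.Surjective π) (hker : ∀ a, π a = 0 → ∃ b, D p b = a)
    (hker' : ∀ b, π (D p b) = 0)
    (hinj : Function.Injective (D p)) {a : A} (h : KoszulLine D' T T (π a)) :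
    KoszulLine D (insert p T) (insert p T) a := by
  have hlt : ∀ S ⊆ T, ∀ q ∈ S, q < p := fun S hS q hq => hp q (hS hq)
  have hpT : ∀ S ⊆ T, p ∉ S := fun S hS h => lt_irrefl _ (hp p (hS h))
  have hsingle : ∀ S ⊆ T, (Pi.single (insert p T) a : Finset ι → A) S = 0 := fun S hS => by
    refine Pi.single_eq_of_ne (fun h => hpT S hS ?_) _
    rw [h]; exact Finset.mem_insert_self _ _
  have hsingle' : ∀ S ⊆ T, (Pi.single (insert p T) a : Finset ι → A) (insert p S) =
      (Pi.single T a : Finset ι → A) S := fun S hS => by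
    by_cases hST : S = T
    · subst hST; simp
    · rw [Pi.single_eq_of_ne hST, Pi.single_eq_of_ne]
      intro h
      apply hST
      rw [← Finset.erase_insert (hpT S hS), h, Finset.erase_insert (hpT T subset_rfl)]
  have hcc : ∀ S ⊆ T, koszulD D (Pi.single T a) S = 0 := fun S hS => by
    rw [koszulD_apply]
    refine Finset.sum_eq_zero fun q hq => ?_
    rw [Pi.single_eq_of_ne, map_zero, smul_zero]
    intro h
    exact Finset.notMem_erase q S (h ▸ hS hq)
  refine ⟨fun f hf => ?_, ?_⟩
  · obtain ⟨c, g', hg'⟩ := h.spans (fun S => π (f (insert p S))) (fun S hS => by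
      have h1 := hf _ (Finset.insert_subset_insert p hS)
      rw [koszulD_insert D f (hlt S hS)] at h1
      rw [koszulD_map (D' := D) π fun q hq => hπ q (hS hq)]
      have h2 := congrArg π h1
      simpa [hker'] using h2)
    choose s hs using hsurj
    let g₁ : Finset ι → A := fun S => s (g' S)
    -- the `p`-components of `f - c • [a] - d g₁` lie in the range of `D p`
    have hex : ∀ S : Finset ι, ∃ b, S ⊆ T → (-1 : ℂ) ^ S.card • D p b =
        f (insert p S) - c • (Pi.single T a : Finset ι → A) S - koszulD D g₁ S := fun S => by
      by_cases hS : S ⊆ T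
      · obtain ⟨b, hb⟩ := hker (f (insert p S) - c • (Pi.single T a : Finset ι → A) S -
          koszulD D g₁ S) (by
            rw [map_sub, map_sub, hg' S hS, map_smul, map_single_apply,
              ← koszulD_map (D' := D) π fun q hq => hπ q (hS hq)]
            simp [g₁, hs])
        exact ⟨(-1 : ℂ) ^ S.card • b, fun _ => by
          rw [map_smul, sign_smul_sign_smul, hb]⟩
      · exact ⟨0, fun h => absurd h hS⟩
    choose g₀ hg₀ using hex
    refine ⟨c, koszulGlue p g₀ g₁, forall_subset_insert ?_ ?_⟩
    · intro S hS
      rw [koszulD_glue_of_lt D _ _ (hlt S hS), hsingle S hS, smul_zero, zero_add, ← sub_eq_zero]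
      apply hinj
      rw [map_zero]
      have h1 := hf _ (Finset.insert_subset_insert p hS)
      rw [koszulD_insert D f (hlt S hS)] at h1
      have h2 := koszulD_sign_smul D hD p g₀ S
      rw [koszulD_congr D
        (g := (fun S => f (insert p S)) - c • (Pi.single T a : Finset ι → A) - koszulD D g₁)
        fun S' hS' => hg₀ S' (hS'.trans hS), map_sub, map_sub, koszulD_koszulD D hD,
        map_smul, Pi.sub_apply, Pi.sub_apply, Pi.smul_apply, hcc S hS] at h2
      rw [smul_zero, sub_zero, Pi.zero_apply, sub_zero] at h2
      rw [h2, ← sub_eq_neg_add, ← smul_sub, ← map_sub] at h1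
      simpa using h1
    · intro S hS
      rw [koszulD_glue_insert D _ _ (hlt S hS), hsingle' S hS, hg₀ S hS]
      abel
  · rintro ⟨g, hg⟩
    refine h.nontrivial ⟨fun S => π (g (insert p S)), fun S hS => ?_⟩
    have h1 := hg _ (Finset.insert_subset_insert p hS)
    rw [koszulD_insert D g (hlt S hS), hsingle' S hS] at h1
    rw [koszulD_map (D' := D) π fun q hq => hπ q (hS hq), ← map_single_apply, h1]
    simp [hker']

/-- Transport along an isomorphism which intertwines the operators. -/
theorem KoszulLine.of_equiv {D : ι → A →ₗ[ℂ] A} {D' : ι → A' →ₗ[ℂ] A'} (φ : A' ≃ₗ[ℂ] A)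
    {T S₀ : Finset ι} (hφ : ∀ q ∈ T, ∀ a, D q (φ a) = φ (D' q a)) {a : A'}
    (h : KoszulLine D' T S₀ a) : KoszulLine D T S₀ (φ a) := by
  have key : ∀ S ⊆ T, ∀ f : Finset ι → A, koszulD D' (fun S => φ.symm (f S)) S =
      φ.symm (koszulD D f S) := fun S hS f => by
    refine koszulD_map (D' := D) φ.symm.toLinearMap (fun q hq b => ?_) f
    apply φ.injective
    simp [← hφ q (hS hq)]
  refine ⟨fun f hf => ?_, ?_⟩
  · obtain ⟨c, g, hg⟩ := h.spans (fun S => φ.symm (f S)) fun S hS => by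
      rw [key S hS, hf S hS, map_zero]
    refine ⟨c, fun S => φ (g S), fun S hS => ?_⟩
    have h1 := congrArg φ (hg S hS)
    have h2 := koszulD_map (D := D) (D' := D') φ.toLinearMap (fun q hq => hφ q (hS hq)) g
    have h3 := map_single_apply φ.toLinearMap S₀ S a
    simp only [LinearEquiv.coe_coe] at h2 h3
    rw [h2, ← h3]
    simpa using h1
  · rintro ⟨g, hg⟩
    refine h.nontrivial ⟨fun S => φ.symm (g S), fun S hS => ?_⟩
    rw [key S hS, ← hg S hS]
    have h3 := map_single_apply φ.symm.toLinearMap S₀ S (φ a)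
    simpa using h3.symm

/-- Without operators the cohomology is the module itself. -/
theorem KoszulLine.empty (D : ι → A →ₗ[ℂ] A) {a : A} (ha : a ≠ 0)
    (h : ∀ b : A, ∃ c : ℂ, b = c • a) : KoszulLine D ∅ ∅ a := by
  refine ⟨fun f _ => ?_, ?_⟩
  · obtain ⟨c, hc⟩ := h (f ∅)
    refine ⟨c, 0, fun S hS => ?_⟩
    rw [Finset.subset_empty.1 hS]
    simpa using hc
  · rintro ⟨g, hg⟩
    have := hg ∅ subset_rfl
    simp [koszulD_apply, ha] at this

/-- The homogeneous component of degree `i` of a cochain. -/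
def koszulComponent {κ : Type*} (i : ℤ) (f : Finset κ → A) (S : Finset κ) : A :=
  if (S.card : ℤ) = i then f S else 0

theorem koszulComponent_mem {κ : Type*} (i : ℤ) (f : Finset κ → A) :
    koszulComponent i f ∈ koszulCochains κ A i := fun _ hS => if_neg hS

theorem koszulD_component (D : ι → A →ₗ[ℂ] A) (i : ℤ) (f : Finset ι → A) :
    koszulD D (koszulComponent (i - 1) f) = koszulComponent i (koszulD D f) := by
  funext S
  by_cases hS : (S.card : ℤ) = i
  · simp only [koszulComponent, hS, if_true, koszulD_apply]
    refine Finset.sum_congr rfl fun p hp => ?_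
    rw [if_pos]
    have := Finset.card_erase_add_one hp
    lia
  · simp only [koszulComponent, hS, if_false]
    have := koszulD_mem D (koszulComponent_mem (i - 1) f) S (by simpa using hS)
    simpa using this

variable [Fintype ι]

/-- If the cohomology is a line spanned by a class at `S₀`, the graded cohomology vanishes in all
degrees other than `#S₀`. -/
theorem KoszulLine.subsingleton {D : ι → A →ₗ[ℂ] A} {S₀ : Finset ι} {a : A}
    (h : KoszulLine D Finset.univ S₀ a) {i : ℤ} (hi : i ≠ S₀.card) :
    Subsingleton (KoszulCohomology D i) := by
  rw [Submodule.Quotient.subsingleton_iff, eq_top_iff]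
  rintro ⟨f, hf, hf'⟩ -
  obtain ⟨c, g, hg⟩ := h.spans f fun S _ => congrFun hf' S
  refine ⟨koszulComponent (i - 1) g, koszulComponent_mem _ _, ?_⟩
  rw [koszulD_component]
  funext S
  by_cases hS : (S.card : ℤ) = i
  · have : S ≠ S₀ := by rintro rfl; exact hi hS.symm
    simp [koszulComponent, hS, hg S (Finset.subset_univ _), this]
  · simp [koszulComponent, hS, hf S hS]

/-- In degree `#S₀` the class at `S₀` spans the cohomology. -/
theorem KoszulLine.span_eq_top {D : ι → A →ₗ[ℂ] A} {S₀ : Finset ι} {a : A}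
    (h : KoszulLine D Finset.univ S₀ a) {i : ℤ} (hi : i = S₀.card)
    (hc : Pi.single S₀ a ∈ koszulCocycles D i) :
    Submodule.span ℂ {(Submodule.Quotient.mk ⟨Pi.single S₀ a, hc⟩ :
      KoszulCohomology D i)} = ⊤ := by
  subst hi
  rw [eq_top_iff]
  rintro x -
  obtain ⟨⟨f, hf⟩, rfl⟩ := Submodule.Quotient.mk_surjective _ x
  obtain ⟨c, g, hg⟩ := h.spans f fun S _ => congrFun hf.2 S
  rw [Submodule.mem_span_singleton]
  refine ⟨c, ?_⟩
  rw [← Submodule.Quotient.mk_smul, eq_comm, Submodule.Quotient.eq]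
  refine ⟨koszulComponent (S₀.card - 1) g, koszulComponent_mem _ _, ?_⟩
  rw [koszulD_component]
  funext S
  by_cases hS : (S.card : ℤ) = S₀.card
  · simp [koszulComponent, hS, hg S (Finset.subset_univ _)]
  · have : S ≠ S₀ := by rintro rfl; exact hS rfl
    simp [koszulComponent, hS, hf.1 S hS, this]

/-- In degree `#S₀` the class at `S₀` does not vanish. -/
theorem KoszulLine.mk_ne_zero {D : ι → A →ₗ[ℂ] A} {S₀ : Finset ι} {a : A}
    (h : KoszulLine D Finset.univ S₀ a) {i : ℤ} (hi : i = S₀.card)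
    (hc : Pi.single S₀ a ∈ koszulCocycles D i) :
    (Submodule.Quotient.mk ⟨Pi.single S₀ a, hc⟩ : KoszulCohomology D i) ≠ 0 := by
  subst hi
  rw [Ne, Submodule.Quotient.mk_eq_zero]
  rintro ⟨g, _, hg⟩
  exact h.nontrivial ⟨g, fun S _ => (congrFun hg S).symm⟩

/-- In degree `#S₀` the cohomology is one-dimensional. -/
theorem KoszulLine.nonempty_equiv {D : ι → A →ₗ[ℂ] A} {S₀ : Finset ι} {a : A}
    (h : KoszulLine D Finset.univ S₀ a) {i : ℤ} (hi : i = S₀.card)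
    (hc : Pi.single S₀ a ∈ koszulCocycles D i) :
    Nonempty (KoszulCohomology D i ≃ₗ[ℂ] ℂ) := by
  have e := LinearEquiv.toSpanNonzeroSingleton ℂ _ _ (h.mk_ne_zero hi hc)
  rw [h.span_eq_top hi hc] at e
  exact ⟨(e.trans Submodule.topEquiv).symm⟩

end KoszulElimination

/-! ### Series and integrals of entire functions -/

section EntireFunctions

open MeasureTheory Metric Set

variable {E : Type*} [NormedAddCommGroup E] [NormedSpace ℂ E]

/-- Cauchy's estimate for the derivative of a function of several variables. -/
theorem norm_fderiv_le_of_ball {f : E → ℂ} (hf : Differentiable ℂ f) {z : E} {C : ℝ}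
    (hC : ∀ w ∈ closedBall z 1, ‖f w‖ ≤ C) : ‖fderiv ℂ f z‖ ≤ C := by
  have hC0 : 0 ≤ C := (norm_nonneg _).trans (hC z (mem_closedBall_self zero_le_one))
  refine ContinuousLinearMap.opNorm_le_bound _ hC0 fun v => ?_
  by_cases hv : v = 0
  · simp [hv]
  have hv' : (0 : ℝ) < ‖v‖ := norm_pos_iff.2 hv
  have hd : Differentiable ℂ fun s : ℂ => f (z + s • v) := hf.comp (by fun_prop)
  have hder : deriv (fun s : ℂ => f (z + s • v)) 0 = fderiv ℂ f z v := by
    have h1 : HasDerivAt (fun s : ℂ => z + s • v) v 0 := by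
      simpa using ((hasDerivAt_id (0 : ℂ)).smul_const v).const_add z
    have h2 : HasFDerivAt f (fderiv ℂ f z) (z + (0 : ℂ) • v) := by
      simpa using (hf z).hasFDerivAt
    exact (h2.comp_hasDerivAt 0 h1).deriv
  rw [← hder]
  have := Complex.norm_deriv_le_of_forall_mem_sphere_norm_le (c := 0) (R := ‖v‖⁻¹) (C := C)
    (inv_pos.2 hv') hd.diffContOnCl fun s hs => hC _ (by
      rw [mem_sphere_zero_iff_norm] at hs
      rw [mem_closedBall_iff_norm, add_sub_cancel_left, norm_smul, hs, inv_mul_cancel₀ hv'.ne'])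
  simpa using this

/-- A locally uniformly absolutely convergent series of entire functions is entire. -/
theorem differentiable_tsum_of_bound {α : Type*} {f : α → E → ℂ}
    (hf : ∀ a, Differentiable ℂ (f a))
    (hb : ∀ R : ℝ, ∃ u : α → ℝ, Summable u ∧ ∀ a z, ‖z‖ ≤ R → ‖f a z‖ ≤ u a) :
    Differentiable ℂ fun z => ∑' a, f a z := by
  intro z
  obtain ⟨u, hu, hfu⟩ := hb (‖z‖ + 1 + 1)
  refine (hasFDerivAt_tsum_of_isPreconnected (f' := fun a w => fderiv ℂ (f a) w) hu
    (isOpen_ball (x := (0 : E)) (ε := ‖z‖ + 1)) ?_ (fun a w _ => (hf a w).hasFDerivAt)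
    (fun a w hw => norm_fderiv_le_of_ball (hf a) fun w' hw' => hfu a w' ?_)
    (x₀ := z) ?_ ?_ ?_).differentiableAt
  · let _ : NormedSpace ℝ E := NormedSpace.restrictScalars ℝ ℂ E
    exact (convex_ball _ _).isPreconnected
  · rw [mem_ball_zero_iff] at hw
    rw [mem_closedBall_iff_norm] at hw'
    have := norm_le_norm_add_norm_sub' w' w
    linarith
  · simp
  · exact Summable.of_norm_bounded hu fun a => hfu a z (by linarith)
  · simp

/-- The integral of a family of entire functions, which depends continuously on a parameter in a
compact set, is entire. -/
theorem differentiable_integral_of_continuous [FiniteDimensional ℂ E] {X : Type*}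
    [TopologicalSpace X] [MeasurableSpace X] [BorelSpace X] {μ : Measure X} [IsFiniteMeasure μ]
    {K : Set X} (hK : IsCompact K) (hμ : ∀ᵐ x ∂μ, x ∈ K) {G : X → E → ℂ}
    (hG : Continuous (Function.uncurry G)) (hd : ∀ x, Differentiable ℂ (G x)) :
    Differentiable ℂ fun z => ∫ x, G x z ∂μ := by
  intro z
  have : ProperSpace E := FiniteDimensional.proper ℂ E
  have : ProperSpace (E →L[ℂ] ℂ) := FiniteDimensional.proper ℂ _
  let _ : MeasurableSpace E := borel E
  have : BorelSpace E := ⟨rfl⟩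
  obtain ⟨C, hC⟩ := (hK.prod (isCompact_closedBall z 2)).exists_bound_of_continuousOn
    hG.continuousOn
  have hmeas : ∀ w, AEStronglyMeasurable (fun x => G x w) μ := fun w =>
    (hG.comp (Continuous.prodMk_left w)).aestronglyMeasurable
  refine (hasFDerivAt_integral_of_dominated_of_fderiv_le (𝕜 := ℂ) (F := fun w x => G x w)
    (F' := fun w x => fderiv ℂ (G x) w) (s := ball z 1) (bound := fun _ => C)
    (ball_mem_nhds z one_pos) (Filter.Eventually.of_forall hmeas) ?_ ?_ ?_
    (integrable_const C) ?_).differentiableAt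
  · exact Integrable.of_bound (hmeas z) C
      (hμ.mono fun x hx => hC (x, z) ⟨hx, mem_closedBall_self zero_le_two⟩)
  · have h := (measurable_fderiv_with_param ℂ hG).comp (measurable_prodMk_right (y := z))
    exact h.stronglyMeasurable.aestronglyMeasurable
  · refine hμ.mono fun x hx w hw => norm_fderiv_le_of_ball (hd x) fun w' hw' => hC (x, w') ⟨hx, ?_⟩
    have h1 := dist_triangle w' w z
    have h2 := mem_ball.1 hw
    have h3 := mem_closedBall.1 hw'
    exact mem_closedBall.2 (by linarith)
  · exact Filter.Eventually.of_forall fun x w _ => (hd x w).hasFDerivAt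

theorem differentiable_circleIntegral [FiniteDimensional ℂ E] {c : ℂ} {r : ℝ} {G : ℂ → E → ℂ}
    (hG : Continuous fun p : ℝ × E => G (circleMap c r p.1) p.2)
    (hd : ∀ θ : ℝ, Differentiable ℂ (G (circleMap c r θ))) :
    Differentiable ℂ fun z => ∮ s in C(c, r), G s z := by
  simp only [circleIntegral, intervalIntegral.integral_of_le Real.two_pi_pos.le]
  refine differentiable_integral_of_continuous (isCompact_Icc (a := 0) (b := 2 * Real.pi)) ?_
    (G := fun θ z => deriv (circleMap c r) θ • G (circleMap c r θ) z) ?_ ?_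
  · exact (ae_restrict_mem measurableSet_Ioc).mono fun x hx => Ioc_subset_Icc_self hx
  · simp only [deriv_circleMap]
    have h : Continuous fun p : ℝ × E => circleMap 0 r p.1 * Complex.I :=
      ((continuous_circleMap 0 r).comp continuous_fst).mul continuous_const
    exact h.smul hG
  · exact fun θ => (hd θ).const_smul (deriv (circleMap c r) θ)

end EntireFunctions

/-! ### The difference equation for entire functions -/

section DifferenceEquation

open Metric

theorem one_half_le_norm_exp_sub_one (m : ℕ) {t : ℂ} (ht : ‖t‖ = (2 * m + 1) * Real.pi) :
    1 / 2 ≤ ‖Complex.exp t - 1‖ := by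
  have hpi := Real.pi_gt_three
  have hr : Real.pi ≤ ‖t‖ := by
    rw [ht]
    have : (0 : ℝ) ≤ m := m.cast_nonneg
    nlinarith
  rcases le_or_gt 1 t.re with h | h
  · have h1 := norm_sub_norm_le (Complex.exp t) 1
    rw [Complex.norm_exp, norm_one] at h1
    linarith [Real.add_one_le_exp t.re]
  rcases le_or_gt t.re (-1) with h' | h'
  · have h1 := norm_sub_norm_le 1 (Complex.exp t)
    rw [Complex.norm_exp, norm_one, norm_sub_rev] at h1
    have h2 : Real.exp t.re ≤ Real.exp (-1) := Real.exp_le_exp.2 h'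
    have h3 := Real.exp_neg_one_lt_d9
    linarith
  · -- here `|Im t|` is so close to an odd multiple of `π` that its cosine is not positive
    have hsq : ‖t‖ ^ 2 = t.re ^ 2 + t.im ^ 2 := by
      rw [Complex.sq_norm, Complex.normSq_apply]; ring
    have hle : |t.im| ≤ ‖t‖ := Complex.abs_im_le_norm t
    have hge : ‖t‖ - 1 ≤ |t.im| := by
      refine abs_le_of_sq_le_sq' ?_ (abs_nonneg _) |>.2
      rw [sq_abs]
      nlinarith
    have hcos : Real.cos t.im ≤ 0 := by
      have h1 : Real.cos t.im = -Real.cos (‖t‖ - |t.im|) := by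
        have h2 : |t.im| = Real.pi - (‖t‖ - |t.im|) + m * (2 * Real.pi) := by
          rw [ht]; ring
        have h3 := congrArg Real.cos h2
        rwa [Real.cos_abs, Real.cos_add_nat_mul_two_pi, Real.cos_pi_sub] at h3
      rw [h1, neg_nonpos]
      exact Real.cos_nonneg_of_neg_pi_div_two_le_of_le (by linarith) (by linarith)
    have h1 := Complex.abs_re_le_norm (Complex.exp t - 1)
    rw [Complex.sub_re, Complex.exp_re, Complex.one_re] at h1
    have h2 := neg_abs_le (Real.exp t.re * Real.cos t.im - 1)
    have h3 := mul_nonpos_of_nonneg_of_nonpos (Real.exp_pos t.re).le hcos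
    have h4 : 1 ≤ |Real.exp t.re * Real.cos t.im - 1| := by
      rw [abs_of_nonpos (by linarith)]
      linarith
    linarith

open MeasureTheory in
theorem circleIntegral_exp_mul_div_pow (m : ℕ) {r : ℝ} (hr : 0 < r) (z : ℂ) :
    ∮ t in C(0, r), Complex.exp (z * t) / t ^ (m + 1) =
      2 * Real.pi * Complex.I / m.factorial * z ^ m := by
  have hd : Differentiable ℂ fun t : ℂ => Complex.exp (z * t) := by fun_prop
  have h := DiffContOnCl.circleIntegral_one_div_sub_center_pow_smul hr m
    (hd.diffContOnCl (s := ball 0 r))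
  have h2 : iteratedDeriv m (fun t : ℂ => Complex.exp (z * t)) 0 = z ^ m := by
    simp [iteratedDeriv_cexp_const_mul]
  rw [h2] at h
  rw [smul_eq_mul] at h
  rw [← h]
  refine circleIntegral.integral_congr hr.le fun t _ => ?_
  simp [div_eq_inv_mul]

/-- An entire solution of `φ (z + 1) - φ z = z ^ m`: the monomial is the `m`-th Taylor coefficient
of `t ↦ exp (z t)` up to a factor, and `exp (z t) / (exp t - 1)` solves the difference equation
for `exp (z t)`. The radius of the circle grows with `m` and keeps away from the poles `2πi ℤ`;
so the solutions grow only geometrically in `m`, unlike the Bernoulli polynomials. -/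
def diffSolution (m : ℕ) (z : ℂ) : ℂ :=
  (m.factorial : ℂ) / (2 * Real.pi * Complex.I) *
    ∮ t in C(0, (2 * m + 1) * Real.pi),
      Complex.exp (z * t) / ((Complex.exp t - 1) * t ^ (m + 1))

theorem diffSolution_radius_pos (m : ℕ) : 0 < (2 * (m : ℝ) + 1) * Real.pi := by
  have := Real.pi_pos
  positivity

theorem exp_sub_one_ne_zero_of_circle (m : ℕ) {t : ℂ} (ht : ‖t‖ = (2 * m + 1) * Real.pi) :
    Complex.exp t - 1 ≠ 0 := by
  rw [← norm_pos_iff]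
  linarith [one_half_le_norm_exp_sub_one m ht]

theorem circle_ne_zero (m : ℕ) {t : ℂ} (ht : ‖t‖ = (2 * m + 1) * Real.pi) : t ≠ 0 := by
  rw [← norm_pos_iff, ht]
  exact diffSolution_radius_pos m

theorem norm_circleMap_radius (m : ℕ) (θ : ℝ) :
    ‖circleMap 0 ((2 * m + 1) * Real.pi) θ‖ = (2 * m + 1) * Real.pi := by
  rw [norm_circleMap_zero, abs_of_pos (diffSolution_radius_pos m)]

theorem differentiable_diffSolution (m : ℕ) : Differentiable ℂ (diffSolution m) := by
  refine Differentiable.const_mul (differentiable_circleIntegral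
    (G := fun t z => Complex.exp (z * t) / ((Complex.exp t - 1) * t ^ (m + 1))) ?_ ?_) _
  · have h : Continuous fun p : ℝ × ℂ => circleMap 0 ((2 * m + 1) * Real.pi) p.1 :=
      (continuous_circleMap _ _).comp continuous_fst
    refine Continuous.div (by fun_prop) (by fun_prop) fun p => mul_ne_zero ?_ (pow_ne_zero _ ?_)
    · exact exp_sub_one_ne_zero_of_circle m (norm_circleMap_radius m _)
    · exact circle_ne_zero m (norm_circleMap_radius m _)
  · intro θ
    exact Differentiable.div_const (by fun_prop) _

theorem circleIntegrable_diffSolution (m : ℕ) (z : ℂ) :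
    CircleIntegrable (fun t => Complex.exp (z * t) / ((Complex.exp t - 1) * t ^ (m + 1))) 0
      ((2 * m + 1) * Real.pi) := by
  refine ContinuousOn.circleIntegrable (diffSolution_radius_pos m).le ?_
  refine ContinuousOn.div (by fun_prop) (by fun_prop) fun t ht => ?_
  rw [mem_sphere_zero_iff_norm] at ht
  exact mul_ne_zero (exp_sub_one_ne_zero_of_circle m ht) (pow_ne_zero _ (circle_ne_zero m ht))

theorem diffSolution_add_one_sub (m : ℕ) (z : ℂ) :
    diffSolution m (z + 1) - diffSolution m z = z ^ m := by
  have hm : (m.factorial : ℂ) ≠ 0 := Nat.cast_ne_zero.2 m.factorial_ne_zero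
  rw [diffSolution, diffSolution, ← mul_sub, ← circleIntegral.integral_sub
    (circleIntegrable_diffSolution m _) (circleIntegrable_diffSolution m _)]
  have h := circleIntegral_exp_mul_div_pow m (diffSolution_radius_pos m) z
  rw [circleIntegral.integral_congr (g := fun t => Complex.exp (z * t) / t ^ (m + 1))
    (diffSolution_radius_pos m).le, h]
  · have := Complex.two_pi_I_ne_zero
    field_simp
  · intro t ht
    rw [mem_sphere_zero_iff_norm] at ht
    have h1 := exp_sub_one_ne_zero_of_circle m ht
    have h2 := circle_ne_zero m ht
    simp only [add_mul, one_mul, Complex.exp_add]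
    field_simp

theorem norm_diffSolution_le (m : ℕ) {z : ℂ} {R : ℝ} (hz : ‖z‖ ≤ R) :
    ‖diffSolution m z‖ ≤ 2 * Real.exp (Real.pi * R) * Real.exp (2 * Real.pi * R) ^ m := by
  set r : ℝ := (2 * m + 1) * Real.pi with hr
  have hr0 : 0 < r := diffSolution_radius_pos m
  have hmr : (m : ℝ) ≤ r := by
    have := Real.pi_gt_three
    have : (0 : ℝ) ≤ m := m.cast_nonneg
    nlinarith
  have hbound : ∀ t ∈ sphere (0 : ℂ) r,
      ‖Complex.exp (z * t) / ((Complex.exp t - 1) * t ^ (m + 1))‖ ≤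
        2 * Real.exp (R * r) / r ^ (m + 1) := by
    intro t ht
    rw [mem_sphere_zero_iff_norm] at ht
    have h1 := one_half_le_norm_exp_sub_one m ht
    rw [norm_div, norm_mul, norm_pow, ht]
    have h2 : ‖Complex.exp (z * t)‖ ≤ Real.exp (R * r) := by
      rw [Complex.norm_exp]
      refine Real.exp_le_exp.2 ((Complex.re_le_norm _).trans ?_)
      rw [norm_mul, ht]
      gcongr
    rw [div_le_div_iff₀ (by positivity) (by positivity)]
    have h3 : Real.exp (R * r) * 1 ≤ Real.exp (R * r) * (2 * ‖Complex.exp t - 1‖) := by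
      gcongr
      linarith
    nlinarith [mul_le_mul_of_nonneg_right h2 (pow_pos hr0 (m + 1)).le,
      mul_le_mul_of_nonneg_right h3 (pow_pos hr0 (m + 1)).le]
  have h := circleIntegral.norm_two_pi_i_inv_smul_integral_le_of_norm_le_const hr0.le hbound
  have hφ : diffSolution m z = m.factorial * ((2 * Real.pi * Complex.I : ℂ)⁻¹ •
      ∮ t in C(0, r), Complex.exp (z * t) / ((Complex.exp t - 1) * t ^ (m + 1))) := by
    rw [diffSolution, smul_eq_mul]
    ring
  have hfac : (m.factorial : ℝ) ≤ r ^ m := by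
    have h1 : (m.factorial : ℝ) ≤ (m : ℝ) ^ m := by exact_mod_cast m.factorial_le_pow
    exact h1.trans (by gcongr)
  rw [hφ, norm_mul, Complex.norm_natCast]
  calc (m.factorial : ℝ) * _ ≤ r ^ m * (r * (2 * Real.exp (R * r) / r ^ (m + 1))) := by gcongr
    _ = 2 * Real.exp (R * r) := by
      field_simp
      ring
    _ = _ := by
      rw [mul_assoc, ← Real.exp_nat_mul, ← Real.exp_add]
      congr 2
      rw [hr]
      ring

variable {E : Type*} [NormedAddCommGroup E] [NormedSpace ℂ E] [FiniteDimensional ℂ E]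

theorem differentiable_iteratedDeriv_line {g : E → ℂ} (hg : Differentiable ℂ g) (P : E →L[ℂ] E)
    (v : E) (m : ℕ) :
    Differentiable ℂ fun Z : E => iteratedDeriv m (fun s : ℂ => g (P Z + s • v)) 0 := by
  have hm : (m.factorial : ℂ) ≠ 0 := Nat.cast_ne_zero.2 m.factorial_ne_zero
  have h : ∀ Z : E, iteratedDeriv m (fun s : ℂ => g (P Z + s • v)) 0 =
      m.factorial / (2 * Real.pi * Complex.I) *
        ∮ s in C(0, 1), (1 / (s - 0) ^ (m + 1)) • g (P Z + s • v) := by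
    intro Z
    have hd : Differentiable ℂ fun s : ℂ => g (P Z + s • v) := hg.comp (by fun_prop)
    rw [DiffContOnCl.circleIntegral_one_div_sub_center_pow_smul one_pos m
      (hd.diffContOnCl (s := ball 0 1)), smul_eq_mul]
    have := Complex.two_pi_I_ne_zero
    field_simp
  simp only [h]
  refine Differentiable.const_mul (differentiable_circleIntegral
    (G := fun s Z => (1 / (s - 0) ^ (m + 1)) • g (P Z + s • v)) ?_ ?_) _
  · have h1 : Continuous fun p : ℝ × E => circleMap 0 1 p.1 :=
      (continuous_circleMap _ _).comp continuous_fst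
    have h2 : Continuous fun p : ℝ × E => 1 / (circleMap 0 1 p.1 - 0) ^ (m + 1) := by
      refine Continuous.div (by fun_prop) (by fun_prop) fun p => ?_
      rw [sub_zero]
      exact pow_ne_zero _ (circleMap_ne_center one_ne_zero)
    have h3 : Continuous fun p : ℝ × E => g (P p.2 + circleMap 0 1 p.1 • v) :=
      hg.continuous.comp (by fun_prop)
    exact h2.smul h3
  · exact fun θ => (hg.comp (by fun_prop)).const_smul (1 / (circleMap 0 1 θ - 0) ^ (m + 1))

/-- The difference equation `f (Z + v) - f Z = g Z` has an entire solution for every entire `g`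
(Guichard's theorem with parameters), and the solution inherits the periods of `g` in a complement
of `v`: expand `g` into powers of the coordinate `c` along `v` and solve for each power. -/
theorem exists_entire_translate_sub_eq {g : E → ℂ} (hg : Differentiable ℂ g) {v : E}
    {c : E →L[ℂ] ℂ} (hc : c v = 1) :
    ∃ f : E → ℂ, Differentiable ℂ f ∧ (∀ Z, f (Z + v) - f Z = g Z) ∧
      ∀ w, c w = 0 → (∀ Z, g (Z + w) = g Z) → ∀ Z, f (Z + w) = f Z := by
  let P : E →L[ℂ] E := ContinuousLinearMap.id ℂ E - c.smulRight v
  have hP : ∀ Z, P Z = Z - c Z • v := fun Z => by simp [P]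
  let a : ℕ → E → ℂ := fun m Z =>
    (m.factorial : ℂ)⁻¹ * iteratedDeriv m (fun s : ℂ => g (P Z + s • v)) 0
  have hline : ∀ Z, Differentiable ℂ fun s : ℂ => g (P Z + s • v) := fun Z =>
    hg.comp (by fun_prop)
  have ha : ∀ m, Differentiable ℂ (a m) := fun m =>
    (differentiable_iteratedDeriv_line hg P v m).const_mul _
  have : ProperSpace E := FiniteDimensional.proper ℂ E
  -- Cauchy estimates on circles of radius `ρ`, where `ρ` is at our disposal
  have hbound : ∀ R ρ : ℝ, 0 < ρ → ∃ C : ℝ, ∀ m Z, ‖Z‖ ≤ R → ‖a m Z‖ ≤ C / ρ ^ m := by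
    intro R ρ hρ
    obtain ⟨C, hC⟩ := ((isCompact_closedBall (0 : E) R).prod
      (isCompact_sphere (0 : ℂ) ρ)).exists_bound_of_continuousOn
      (f := fun p : E × ℂ => g (P p.1 + p.2 • v))
      (hg.continuous.comp (by fun_prop)).continuousOn
    refine ⟨C, fun m Z hZ => ?_⟩
    have h := Complex.norm_iteratedDeriv_le_of_forall_mem_sphere_norm_le m hρ
      (hline Z).diffContOnCl fun s hs => hC (Z, s) ⟨mem_closedBall_zero_iff.2 hZ, hs⟩
    have hm : (0 : ℝ) < m.factorial := Nat.cast_pos.2 m.factorial_pos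
    rw [norm_mul, norm_inv, Complex.norm_natCast, inv_mul_le_iff₀ hm, ← mul_div_assoc]
    exact h
  have hterm : ∀ R : ℝ, ∃ u : ℕ → ℝ, Summable u ∧
      ∀ m Z, ‖Z‖ ≤ R → ‖a m Z * diffSolution m (c Z)‖ ≤ u m := by
    intro R
    set B : ℝ := Real.exp (2 * Real.pi * (‖c‖ * R)) with hB
    have hB0 : 0 < B := Real.exp_pos _
    obtain ⟨C, hC⟩ := hbound R (2 * B) (by positivity)
    refine ⟨fun m => C * (2 * Real.exp (Real.pi * (‖c‖ * R))) * (1 / 2) ^ m,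
      summable_geometric_two.mul_left _, fun m Z hZ => ?_⟩
    have h1 := hC m Z hZ
    have h2 := norm_diffSolution_le m (z := c Z) (R := ‖c‖ * R)
      ((c.le_opNorm Z).trans (by gcongr))
    rw [norm_mul]
    refine (mul_le_mul h1 h2 (norm_nonneg _) ((norm_nonneg _).trans h1)).trans_eq ?_
    rw [← hB]
    simp only [mul_pow, one_div, inv_pow]
    field_simp
  have hsum : ∀ Z, Summable fun m => a m Z * diffSolution m (c Z) := fun Z => by
    obtain ⟨u, hu, h⟩ := hterm ‖Z‖
    exact Summable.of_norm_bounded hu fun m => h m Z le_rfl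
  refine ⟨fun Z => ∑' m, a m Z * diffSolution m (c Z), ?_, fun Z => ?_, fun w hw hgw Z => ?_⟩
  · exact differentiable_tsum_of_bound
      (fun m => (ha m).mul ((differentiable_diffSolution m).comp c.differentiable)) hterm
  · have hPv : P (Z + v) = P Z := by
      rw [hP, hP, map_add, hc, add_smul, one_smul]
      abel
    have hav : ∀ m, a m (Z + v) = a m Z := fun m => by simp only [a, hPv]
    rw [← (hsum (Z + v)).tsum_sub (hsum Z)]
    simp only [hav, map_add, hc, ← mul_sub, diffSolution_add_one_sub]
    have h := Complex.taylorSeries_eq_of_entire' 0 (c Z) (hline Z)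
    simp only [sub_zero] at h
    rw [h, hP, sub_add_cancel]
  · have hPw : P (Z + w) = P Z + w := by
      rw [hP, hP, map_add, hw, add_zero]
      abel
    have haw : ∀ m, a m (Z + w) = a m Z := fun m => by
      have : (fun s : ℂ => g (P Z + w + s • v)) = fun s : ℂ => g (P Z + s • v) := by
        funext s
        rw [add_right_comm, hgw]
      simp only [a, hPw, this]
    simp only [haw, map_add, hw, add_zero]

end DifferenceEquation

/-! ### The translation directions -/

section TranslationDirections

variable {n : ℕ}

theorem diff_inr_apply (Ω : Matrix (Fin n) (Fin n) ℂ) (N M : Module.Basis (Fin n) ℤ (Fin n → ℤ))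
    (i : Fin n) (f : Entire n) (Z : Fin n → ℂ) :
    (diff Ω N M (Sum.inrₗ i) f).1 Z = f.1 (Z + toC (M i)) - f.1 Z := by
  change Complex.exp (2 * Real.pi * Complex.I * (toC 0 ⬝ᵥ Z)) *
    Complex.exp (Real.pi * Complex.I * (toC 0 ⬝ᵥ Ω *ᵥ toC 0)) *
      f.1 (Z + toC (M i) + Ω *ᵥ toC 0) - f.1 Z = _
  have h : toC (0 : Fin n → ℤ) = 0 := by funext j; simp [toC]
  simp [h]

/-- The coordinate functional of an integral basis, extended to complex vectors. -/
def coordC (M : Module.Basis (Fin n) ℤ (Fin n → ℤ)) (j : Fin n) : (Fin n → ℂ) →L[ℂ] ℂ :=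
  ∑ i, ((M.coord j (Pi.single i 1) : ℤ) : ℂ) • ContinuousLinearMap.proj i

theorem coordC_toC (M : Module.Basis (Fin n) ℤ (Fin n → ℤ)) (j : Fin n) (v : Fin n → ℤ) :
    coordC M j (toC v) = ((M.coord j v : ℤ) : ℂ) := by
  have h : M.coord j v = ∑ i, v i * M.coord j (Pi.single i 1) := by
    conv_lhs => rw [pi_eq_sum_univ' v, map_sum]
    exact Finset.sum_congr rfl fun i _ => by rw [map_smul, smul_eq_mul]
  rw [h]
  simp [coordC, toC, mul_comm]

/-- The entire functions which are invariant under the translations by `M i`, `l ≤ i`. -/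
def tailPeriodic (Ω : Matrix (Fin n) (Fin n) ℂ) (N M : Module.Basis (Fin n) ℤ (Fin n → ℤ))
    (l : ℕ) : Submodule ℂ (Entire n) where
  carrier := {f | ∀ i : Fin n, l ≤ i → diff Ω N M (Sum.inrₗ i) f = 0}
  add_mem' hf hg i hi := by rw [map_add, hf i hi, hg i hi, add_zero]
  zero_mem' i _ := map_zero _
  smul_mem' c f hf i hi := by rw [map_smul, hf i hi, smul_zero]

theorem mem_tailPeriodic {Ω : Matrix (Fin n) (Fin n) ℂ}
    {N M : Module.Basis (Fin n) ℤ (Fin n → ℤ)} {l : ℕ} {f : Entire n} :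
    f ∈ tailPeriodic Ω N M l ↔ ∀ i : Fin n, l ≤ i → ∀ Z, f.1 (Z + toC (M i)) = f.1 Z := by
  refine forall₂_congr fun i _ => ⟨fun h Z => ?_, fun h => ?_⟩
  · rw [← sub_eq_zero, ← diff_inr_apply Ω N M i f Z, h]
    rfl
  · ext Z
    rw [diff_inr_apply, h, sub_self]
    rfl

theorem tailPeriodic_mono (Ω : Matrix (Fin n) (Fin n) ℂ)
    (N M : Module.Basis (Fin n) ℤ (Fin n → ℤ)) :
    Monotone (tailPeriodic Ω N M) := fun _ _ h _ hf i hi => hf i (h.trans hi)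

/-- The differentials on the functions with periods `M i`, `l ≤ i`. -/
def diffOn {Ω : Matrix (Fin n) (Fin n) ℂ} (hΩ : Ω.IsSymm)
    (N M : Module.Basis (Fin n) ℤ (Fin n → ℤ)) (l : ℕ) (p : Dir n) :
    tailPeriodic Ω N M l →ₗ[ℂ] tailPeriodic Ω N M l :=
  (diff Ω N M p).restrict fun f hf i hi => by rw [diff_comm hΩ, hf i hi, map_zero]

theorem diffOn_apply {Ω : Matrix (Fin n) (Fin n) ℂ} (hΩ : Ω.IsSymm)
    (N M : Module.Basis (Fin n) ℤ (Fin n → ℤ)) (l : ℕ) (p : Dir n) (f : tailPeriodic Ω N M l) :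
    (diffOn hΩ N M l p f : Entire n) = diff Ω N M p f := rfl

/-- The directions which belong to `N_1, …, N_n, M_1, …, M_l`. -/
def dirsBelow (n l : ℕ) : Finset (Dir n) :=
  Finset.univ.filter fun p => ∀ i : Fin n, p = Sum.inrₗ i → (i : ℕ) < l

theorem dirsBelow_zero : dirsBelow n 0 = topIndex n n := by
  ext p
  simp only [dirsBelow, topIndex, Finset.mem_filter, Finset.mem_univ, true_and, not_lt_zero,
    imp_false, Fin.is_lt]
  obtain ⟨j | i, rfl⟩ := toLex.surjective p
  · exact ⟨fun _ => ⟨j, rfl⟩, fun _ i h => by simp [Sum.inrₗ] at h⟩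
  · exact ⟨fun h => absurd rfl (h i), fun ⟨j, h⟩ => by simp [Sum.inlₗ] at h⟩

theorem dirsBelow_self : dirsBelow n n = Finset.univ := by
  ext p
  simp [dirsBelow]

theorem dirsBelow_succ {l : ℕ} (hl : l < n) :
    dirsBelow n (l + 1) = insert (Sum.inrₗ ⟨l, hl⟩) (dirsBelow n l) := by
  ext p
  simp only [dirsBelow, Finset.mem_filter, Finset.mem_univ, true_and, Finset.mem_insert]
  constructor
  · intro h
    by_cases hp : p = Sum.inrₗ ⟨l, hl⟩
    · exact Or.inl hp
    · refine Or.inr fun i hi => lt_of_le_of_ne (Nat.lt_succ_iff.1 (h i hi)) fun h' => hp ?_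
      rw [hi]
      exact congrArg _ (Fin.ext h')
  · rintro (rfl | h) i hi
    · have : (⟨l, hl⟩ : Fin n) = i := by simpa [Sum.inrₗ] using hi
      rw [← this]
      exact Nat.lt_succ_self l
    · exact (h i hi).trans (Nat.lt_succ_self l)

theorem lt_of_mem_dirsBelow {l : ℕ} (hl : l < n) {q : Dir n} (hq : q ∈ dirsBelow n l) :
    q < Sum.inrₗ ⟨l, hl⟩ := by
  have h := (Finset.mem_filter.1 hq).2
  obtain ⟨j | i, rfl⟩ := toLex.surjective q
  · exact Sum.Lex.inl_lt_inr _ _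
  · exact Sum.Lex.inr_lt_inr_iff.2 (h i rfl)

/-- The translation directions contribute nothing to the cohomology: it may be computed from the
operators `N_j` on the functions with all periods `M_i`. -/
theorem KoszulLine.of_tailPeriodic {Ω : Matrix (Fin n) (Fin n) ℂ} (hΩ : Ω.IsSymm)
    (N M : Module.Basis (Fin n) ℤ (Fin n → ℤ)) {S₀ : Finset (Dir n)} (hS₀ : S₀ ⊆ topIndex n n)
    {θ : tailPeriodic Ω N M 0} (h : KoszulLine (diffOn hΩ N M 0) (topIndex n n) S₀ θ) :
    KoszulLine (diff Ω N M) Finset.univ S₀ (θ : Entire n) := by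
  have key : ∀ l ≤ n, KoszulLine (diffOn hΩ N M l) (dirsBelow n l) S₀
      (Submodule.inclusion (tailPeriodic_mono Ω N M (Nat.zero_le l)) θ) := by
    intro l
    induction l with
    | zero => exact fun _ => dirsBelow_zero (n := n) ▸ h
    | succ l ih =>
      intro hl
      have hl' : l < n := hl
      have hle : tailPeriodic Ω N M l ≤ tailPeriodic Ω N M (l + 1) :=
        tailPeriodic_mono Ω N M (Nat.le_succ l)
      rw [dirsBelow_succ hl']
      refine KoszulLine.of_surjective (A := tailPeriodic Ω N M (l + 1))
        (A' := tailPeriodic Ω N M l) (D := diffOn hΩ N M (l + 1)) (D' := diffOn hΩ N M l)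
        (fun p q f => Subtype.ext (diff_comm hΩ N M p q f)) (Submodule.inclusion hle)
        (fun q hq => lt_of_mem_dirsBelow hl' hq) ?_ (fun q _ f => rfl)
        (Submodule.inclusion_injective hle) ?_ ?_ ?_ (ih hl'.le)
      · refine hS₀.trans ?_
        rw [← dirsBelow_zero]
        intro p hp
        simp only [dirsBelow, Finset.mem_filter, Finset.mem_univ, true_and] at hp ⊢
        exact fun i hi => absurd (hp i hi) (Nat.not_lt_zero _)
      · intro f hf
        refine ⟨⟨f, fun i hi => ?_⟩, rfl⟩
        rcases hi.eq_or_lt with h' | h'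
        · have : i = ⟨l, hl'⟩ := Fin.ext h'.symm
          rw [this]
          exact congrArg Subtype.val hf
        · exact f.2 i h'
      · exact fun f => Subtype.ext (f.2 ⟨l, hl'⟩ le_rfl)
      · rintro ⟨g, hg⟩
        rw [mem_tailPeriodic] at hg
        obtain ⟨f, hf, hfg, hper⟩ := exists_entire_translate_sub_eq g.2
          (v := toC (M ⟨l, hl'⟩)) (c := coordC M ⟨l, hl'⟩) (by simp [coordC_toC])
        refine ⟨⟨⟨f, hf⟩, mem_tailPeriodic.2 fun i hi => hper _ ?_ (hg i hi)⟩, ?_⟩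
        · have hne : i ≠ ⟨l, hl'⟩ := fun h' => by
            rw [h'] at hi
            exact absurd hi (Nat.not_succ_le_self l)
          rw [coordC_toC, Module.Basis.coord_apply, M.repr_self, Finsupp.single_eq_of_ne hne.symm,
            Int.cast_zero]
        · refine Subtype.ext (Subtype.ext (funext fun Z => ?_))
          rw [diffOn_apply, diff_inr_apply]
          exact hfg Z
  have htop : tailPeriodic Ω N M n = ⊤ :=
    eq_top_iff.2 fun f _ i hi => absurd i.2 (not_lt.2 hi)
  have h1 := (key n le_rfl).of_equiv (D := diff Ω N M) (LinearEquiv.ofTop _ htop)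
    fun q _ f => rfl
  rw [dirsBelow_self] at h1
  exact h1

end TranslationDirections

/-! ### Completing the square -/

section SplitForms

variable {m : ℕ}

/-- A symmetric bilinear form on `ℝᵐ` which is positive definite on the span of the last `m - k`
unit vectors and negative definite on the orthogonal complement of this span. -/
structure IsSplitForm (k : ℕ) (b : LinearMap.BilinForm ℝ (Fin m → ℝ)) : Prop where
  symm : ∀ x y, b x y = b y x
  pos : ∀ x, x ≠ 0 → (∀ i : Fin m, (i : ℕ) < k → x i = 0) → 0 < b x x
  neg : ∀ x, x ≠ 0 → (∀ y, (∀ i : Fin m, (i : ℕ) < k → y i = 0) → b x y = 0) → b x x < 0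

/-- Prolongation of a vector by the coordinate `-l x`. -/
def snocNeg (l : (Fin m → ℝ) →ₗ[ℝ] ℝ) : (Fin m → ℝ) →ₗ[ℝ] (Fin (m + 1) → ℝ) where
  toFun x := Fin.snoc (α := fun _ => ℝ) x (-l x)
  map_add' x y := by
    funext i
    refine Fin.lastCases ?_ (fun j => ?_) i <;> simp [add_comm]
  map_smul' c x := by
    funext i
    refine Fin.lastCases ?_ (fun j => ?_) i <;> simp

theorem snocNeg_castSucc (l : (Fin m → ℝ) →ₗ[ℝ] ℝ) (x : Fin m → ℝ) (i : Fin m) :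
    snocNeg l x i.castSucc = x i := by simp [snocNeg]

theorem snoc_eq_snocNeg_add (l : (Fin m → ℝ) →ₗ[ℝ] ℝ) (x : Fin m → ℝ) (t : ℝ) :
    (Fin.snoc (α := fun _ => ℝ) x t : Fin (m + 1) → ℝ) =
      snocNeg l x + (t + l x) • Pi.single (Fin.last m) 1 := by
  funext i
  refine Fin.lastCases ?_ (fun j => ?_) i
  · simp [snocNeg]
  · simp [snocNeg]

/-- The form `b` is `g (t + l x) ^ 2 + b' x x` at the vector with last coordinate `t` and
remaining coordinates `x`. -/
def CompletesSquare (b : LinearMap.BilinForm ℝ (Fin (m + 1) → ℝ))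
    (b' : LinearMap.BilinForm ℝ (Fin m → ℝ)) (g : ℝ) (l : (Fin m → ℝ) →ₗ[ℝ] ℝ) : Prop :=
  ∀ x t, b (Fin.snoc (α := fun _ => ℝ) x t) (Fin.snoc (α := fun _ => ℝ) x t) =
    g * (t + l x) ^ 2 + b' x x

/-- The square in the last variable can be completed, and what remains is a form of the same
kind. -/
theorem IsSplitForm.exists_schur {k : ℕ} {b : LinearMap.BilinForm ℝ (Fin (m + 1) → ℝ)}
    (hb : IsSplitForm k b) :
    ∃ (b' : LinearMap.BilinForm ℝ (Fin m → ℝ)) (g : ℝ) (l : (Fin m → ℝ) →ₗ[ℝ] ℝ),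
      IsSplitForm k b' ∧ (k ≤ m → 0 < g) ∧ (m < k → g < 0) ∧
      CompletesSquare b b' g l := by
  set e : Fin (m + 1) → ℝ := Pi.single (Fin.last m) 1 with he
  have he0 : e ≠ 0 := by simp [he]
  have hgpos : k ≤ m → 0 < b e e := fun hk => hb.pos e he0 fun i hi => by
    refine Pi.single_eq_of_ne (fun h => ?_) _
    rw [h, Fin.val_last] at hi
    lia
  have hgneg : m < k → b e e < 0 := fun hk => hb.neg e he0 fun y hy => by
    have : y = 0 := funext fun i => hy i (by have := i.2; lia)
    rw [this, map_zero]
  have hg : b e e ≠ 0 := by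
    rcases le_or_gt k m with h | h
    · exact (hgpos h).ne'
    · exact (hgneg h).ne
  let l : (Fin m → ℝ) →ₗ[ℝ] ℝ := (b e e)⁻¹ • (LinearMap.flip b e).comp (snocNeg 0)
  let S := snocNeg l
  have hS : ∀ x, S x = snocNeg 0 x - l x • e := fun x => by
    have h1 := snoc_eq_snocNeg_add l x 0
    have h2 := snoc_eq_snocNeg_add 0 x 0
    rw [h1] at h2
    simp only [zero_add, LinearMap.zero_apply, zero_smul, add_zero] at h2
    rw [← h2, add_sub_cancel_right]
  have horth : ∀ x, b (S x) e = 0 := fun x => by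
    rw [hS, map_sub, map_smul, LinearMap.sub_apply, LinearMap.smul_apply, smul_eq_mul]
    simp only [l, LinearMap.smul_apply, LinearMap.comp_apply, LinearMap.flip_apply, smul_eq_mul]
    field_simp
    ring
  have hSne : ∀ x, x ≠ 0 → S x ≠ 0 := fun x hx h => hx <| funext fun i => by
    rw [← snocNeg_castSucc l x i]
    exact congrFun h _
  refine ⟨b.compl₁₂ S S, b e e, l, ⟨fun x y => hb.symm _ _, fun x hx hx' => ?_, fun x hx hx' => ?_⟩,
    hgpos, hgneg, fun x t => ?_⟩
  · refine hb.pos _ (hSne x hx) (Fin.lastCases (fun h => ?_) fun i hi => ?_)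
    · exact absurd (funext fun i => hx' i (i.2.trans h)) hx
    · rw [snocNeg_castSucc]
      exact hx' i hi
  · refine hb.neg _ (hSne x hx) fun y hy => ?_
    have h1 := snoc_eq_snocNeg_add l (Fin.init y) (y (Fin.last m))
    rw [Fin.snoc_init_self] at h1
    rw [h1, map_add, map_smul, horth, smul_zero, add_zero]
    exact hx' _ fun i hi => hy i.castSucc hi
  · rw [snoc_eq_snocNeg_add l]
    have h1 : b e (S x) = 0 := (hb.symm _ _).trans (horth x)
    have h2 := horth x
    simp only [S] at h1 h2
    simp only [map_add, map_smul, LinearMap.add_apply, LinearMap.smul_apply, smul_eq_mul,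
      LinearMap.compl₁₂_apply, ← he, h1, h2, S]
    ring

end SplitForms

/-! ### Coefficient spaces -/

section CoefficientSpaces

variable {m : ℕ}

/-- The norm `∑ |x i|` of an integral vector. -/
def norm₁ (x : Fin m → ℤ) : ℝ := ∑ i, |(x i : ℝ)|

theorem norm₁_nonneg (x : Fin m → ℤ) : 0 ≤ norm₁ x := Finset.sum_nonneg fun _ _ => abs_nonneg _

theorem norm₁_sub_le (x y : Fin m → ℤ) : norm₁ (x - y) ≤ norm₁ x + norm₁ y := by
  rw [norm₁, norm₁, norm₁, ← Finset.sum_add_distrib]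
  refine Finset.sum_le_sum fun i _ => ?_
  rw [Pi.sub_apply, Int.cast_sub]
  exact abs_sub _ _

theorem norm₁_snoc (x : Fin m → ℤ) (t : ℤ) :
    norm₁ (Fin.snoc (α := fun _ => ℤ) x t) = norm₁ x + |(t : ℝ)| := by
  simp [norm₁, Fin.sum_univ_castSucc]

theorem toR_snoc (x : Fin m → ℤ) (t : ℤ) :
    toR (Fin.snoc (α := fun _ => ℤ) x t) = Fin.snoc (α := fun _ => ℝ) (toR x) (t : ℝ) := by
  funext i
  refine Fin.lastCases ?_ (fun j => ?_) i <;> simp [toR]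

theorem exists_abs_le_norm₁ (l : (Fin m → ℝ) →ₗ[ℝ] ℝ) :
    ∃ L : ℝ, 0 ≤ L ∧ ∀ x : Fin m → ℤ, |l (toR x)| ≤ L * norm₁ x := by
  refine ⟨∑ i, |l (Pi.single i 1)|, Finset.sum_nonneg fun _ _ => abs_nonneg _, fun x => ?_⟩
  rw [pi_eq_sum_univ' (toR x), map_sum, norm₁, Finset.mul_sum]
  refine (Finset.abs_sum_le_sum_abs _ _).trans (Finset.sum_le_sum fun i _ => ?_)
  rw [map_smul, smul_eq_mul, abs_mul, mul_comm]
  refine mul_le_mul_of_nonneg_right ?_ (abs_nonneg _)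
  exact Finset.single_le_sum (f := fun i => |l (Pi.single i 1)|) (fun _ _ => abs_nonneg _)
    (Finset.mem_univ i)

/-- The functions on `ℤᵐ` of growth at most `exp (π b(x, x) - R |x|)` for every `R`. These are the
coefficients of everywhere convergent series in functions of size `exp (-π b(x, x) + O(|x|))`. -/
def coeffSpace (b : LinearMap.BilinForm ℝ (Fin m → ℝ)) : Submodule ℂ ((Fin m → ℤ) → ℂ) where
  carrier := {a | ∀ R : ℝ, ∃ C : ℝ, ∀ x,
    ‖a x‖ ≤ C * Real.exp (Real.pi * b (toR x) (toR x) - R * norm₁ x)}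
  add_mem' {a a'} ha ha' R := by
    obtain ⟨C, hC⟩ := ha R
    obtain ⟨C', hC'⟩ := ha' R
    refine ⟨C + C', fun x => (norm_add_le _ _).trans ?_⟩
    rw [add_mul]
    exact add_le_add (hC x) (hC' x)
  zero_mem' R := ⟨0, fun x => by simp⟩
  smul_mem' c a ha R := by
    obtain ⟨C, hC⟩ := ha R
    refine ⟨‖c‖ * C, fun x => ?_⟩
    rw [Pi.smul_apply, norm_smul, mul_assoc]
    exact mul_le_mul_of_nonneg_left (hC x) (norm_nonneg c)

variable {b : LinearMap.BilinForm ℝ (Fin m → ℝ)}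

theorem nonneg_of_coeff_bound {a : (Fin m → ℤ) → ℂ} {C : ℝ} {w : (Fin m → ℤ) → ℝ}
    (h : ∀ x, ‖a x‖ ≤ C * Real.exp (w x)) : 0 ≤ C := by
  have := (norm_nonneg _).trans (h 0)
  exact nonneg_of_mul_nonneg_left this (Real.exp_pos _)

theorem shift_mem_coeffSpace {a : (Fin m → ℤ) → ℂ} (ha : a ∈ coeffSpace b)
    (v : Fin m → ℤ) : (fun x => a (x - v)) ∈ coeffSpace b := by
  intro R
  obtain ⟨L, hL0, hL⟩ := exists_abs_le_norm₁ (LinearMap.flip b (toR v) + b (toR v))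
  obtain ⟨C, hC⟩ := ha (|R| + Real.pi * L)
  have hC0 := nonneg_of_coeff_bound hC
  refine ⟨C * Real.exp (Real.pi * b (toR v) (toR v) + (|R| + Real.pi * L) * norm₁ v),
    fun x => (hC _).trans ?_⟩
  rw [mul_assoc, ← Real.exp_add]
  refine mul_le_mul_of_nonneg_left (Real.exp_le_exp.2 ?_) hC0
  have h1 : toR (x - v) = toR x - toR v := by funext i; simp [toR]
  have h2 : norm₁ x ≤ norm₁ (x - v) + norm₁ v := by
    simpa [norm₁] using norm₁_sub_le (x - v) (-v)
  have h3 := (neg_abs_le _).trans' (neg_le_neg (hL x))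
  simp only [LinearMap.add_apply, LinearMap.flip_apply] at h3
  have h4 := mul_le_mul_of_nonneg_left h3 Real.pi_pos.le
  have h5 := mul_le_mul_of_nonneg_left h2 (by positivity : 0 ≤ |R| + Real.pi * L)
  have h6 := mul_le_mul_of_nonneg_right (le_abs_self R) (norm₁_nonneg x)
  rw [h1]
  simp only [map_sub, LinearMap.sub_apply]
  nlinarith

/-- Translation of coefficients. -/
def coeffShift (b : LinearMap.BilinForm ℝ (Fin m → ℝ)) (v : Fin m → ℤ) :
    coeffSpace b →ₗ[ℂ] coeffSpace b where
  toFun a := ⟨fun x => a.1 (x - v), shift_mem_coeffSpace a.2 v⟩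
  map_add' _ _ := rfl
  map_smul' _ _ := rfl

/-- The unit vector in `ℤᵐ` at the index `p`; it is `0` if `m ≤ p`. -/
def unitAt (m p : ℕ) (i : Fin m) : ℤ := if (i : ℕ) = p then 1 else 0

/-- The difference operators on coefficients, indexed by the directions of the complex. -/
def coeffDiff {n : ℕ} (b : LinearMap.BilinForm ℝ (Fin m → ℝ)) (p : Dir n) :
    coeffSpace b →ₗ[ℂ] coeffSpace b :=
  match ofLex p with
  | Sum.inl j => coeffShift b (unitAt m j) - LinearMap.id
  | Sum.inr _ => 0

theorem coeffDiff_inl_apply {n : ℕ} (j : Fin n) (a : coeffSpace b) (x : Fin m → ℤ) :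
    (coeffDiff b (Sum.inlₗ j : Dir n) a).1 x = a.1 (x - unitAt m j) - a.1 x := rfl

theorem coeffDiff_comm {n : ℕ} (p q : Dir n) (a : coeffSpace b) :
    coeffDiff b p (coeffDiff b q a) = coeffDiff b q (coeffDiff b p a) := by
  obtain ⟨j | j, rfl⟩ := toLex.surjective p <;> obtain ⟨j' | j', rfl⟩ := toLex.surjective q
  · refine Subtype.ext (funext fun x => ?_)
    change a.1 (x - unitAt m j - unitAt m j') - a.1 (x - unitAt m j) -
      (a.1 (x - unitAt m j') - a.1 x) = a.1 (x - unitAt m j' - unitAt m j) -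
      a.1 (x - unitAt m j') - (a.1 (x - unitAt m j) - a.1 x)
    rw [sub_right_comm x]
    ring
  · exact map_zero _
  · exact (map_zero _).symm
  · rfl

theorem snoc_sub_unitAt_last (x : Fin m → ℤ) (t : ℤ) :
    (Fin.snoc (α := fun _ => ℤ) x t : Fin (m + 1) → ℤ) - unitAt (m + 1) m =
      Fin.snoc (α := fun _ => ℤ) x (t - 1) := by
  funext i
  refine Fin.lastCases ?_ (fun j => ?_) i
  · simp [unitAt]
  · simp [unitAt, j.2.ne]

theorem snoc_sub_unitAt_of_lt (x : Fin m → ℤ) (t : ℤ) {p : ℕ} (hp : p < m) :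
    (Fin.snoc (α := fun _ => ℤ) x t : Fin (m + 1) → ℤ) - unitAt (m + 1) p =
      Fin.snoc (α := fun _ => ℤ) (x - unitAt m p) t := by
  funext i
  refine Fin.lastCases ?_ (fun j => ?_) i
  · simp [unitAt, hp.ne']
  · simp [unitAt]

theorem forall_snoc {P : (Fin (m + 1) → ℤ) → Prop} :
    (∀ y, P y) ↔ ∀ x t, P (Fin.snoc (α := fun _ => ℤ) x t) :=
  ⟨fun h x t => h _, fun h y => by simpa using h (Fin.init y) (y (Fin.last m))⟩

end CoefficientSpaces

/-! ### Elimination of one variable -/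

section Elimination

variable {m : ℕ} {b : LinearMap.BilinForm ℝ (Fin (m + 1) → ℝ)}
  {b' : LinearMap.BilinForm ℝ (Fin m → ℝ)} {g : ℝ} {l : (Fin m → ℝ) →ₗ[ℝ] ℝ}

/-- Prolongation of an integral vector by one coordinate. -/
abbrev snocZ (x : Fin m → ℤ) (t : ℤ) : Fin (m + 1) → ℤ := Fin.snoc (α := fun _ => ℤ) x t

/-- The integer nearest to the vertex `-l x` of the parabola `t ↦ (t + l x) ^ 2`. -/
def vertex (l : (Fin m → ℝ) →ₗ[ℝ] ℝ) (x : Fin m → ℤ) : ℤ := round (-l (toR x))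

theorem abs_vertex_add_le (l : (Fin m → ℝ) →ₗ[ℝ] ℝ) (x : Fin m → ℤ) :
    |(vertex l x : ℝ) + l (toR x)| ≤ 1 / 2 := by
  have h := abs_sub_round (-l (toR x))
  rwa [← abs_neg, neg_sub, sub_neg_eq_add] at h

theorem summable_exp_neg_abs : Summable fun d : ℤ => Real.exp (-|(d : ℝ)|) := by
  refine Summable.of_nat_of_neg ?_ ?_ <;>
  · simp only [Int.cast_neg, abs_neg, Int.cast_natCast, Nat.abs_cast]
    exact Real.summable_exp_neg_nat

theorem form_snoc (hbb : CompletesSquare b b' g l) (x : Fin m → ℤ) (t : ℤ) :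
    b (toR (snocZ x t)) (toR (snocZ x t)) =
      g * (t + l (toR x)) ^ 2 + b' (toR x) (toR x) := by
  rw [toR_snoc, hbb]

/-- The exponents along a line in the last direction: moving away from `t` on the side where the
weight decreases gains enough to beat any exponential. -/
theorem exists_exponent_bound (hg : g ≠ 0) (R : ℝ) :
    ∃ K : ℝ, ∀ (s t : ℤ) (lam : ℝ),
      g * (s + lam) ^ 2 ≤ g * (t + lam) ^ 2 - |g| * (|(t - s : ℝ)| ^ 2 - |(t - s : ℝ)|) →
      Real.pi * (g * (s + lam) ^ 2) - R * |(s : ℝ)| ≤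
        K + (Real.pi * (g * (t + lam) ^ 2) - R * |(t : ℝ)|) - |(t - s : ℝ)| := by
  have hg' : 0 < Real.pi * |g| := mul_pos Real.pi_pos (abs_pos.2 hg)
  set B := |R| + 1 + Real.pi * |g| with hB
  refine ⟨B ^ 2 / (4 * (Real.pi * |g|)), fun s t lam h => ?_⟩
  set d := |(t - s : ℝ)| with hd
  have h1 : -(R * |(s : ℝ)|) ≤ -(R * |(t : ℝ)|) + |R| * d := by
    have h2 : |R * (|(t : ℝ)| - |(s : ℝ)|)| ≤ |R| * d := by
      rw [abs_mul]
      exact mul_le_mul_of_nonneg_left (abs_abs_sub_abs_le _ _) (abs_nonneg R)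
    have h3 := (abs_le.1 h2).2
    linarith
  have h4 := mul_le_mul_of_nonneg_left h Real.pi_pos.le
  have h5 : B * d ≤ B ^ 2 / (4 * (Real.pi * |g|)) + Real.pi * |g| * d ^ 2 := by
    have h6 : 0 ≤ (B - 2 * (Real.pi * |g|) * d) ^ 2 / (4 * (Real.pi * |g|)) := by positivity
    have h7 : (B - 2 * (Real.pi * |g|) * d) ^ 2 / (4 * (Real.pi * |g|)) =
        B ^ 2 / (4 * (Real.pi * |g|)) - B * d + Real.pi * |g| * d ^ 2 := by
      have : |g| ≠ 0 := abs_ne_zero.2 hg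
      field_simp
      ring
    linarith
  rw [hB] at h5 ⊢
  nlinarith

/-- Summation along the last direction against a bounded kernel, which at `t` only sees places `s`
with smaller weight, preserves the growth conditions. -/
theorem kernel_sum_bound (hg : g ≠ 0)
    (hbb : CompletesSquare b b' g l)
    {κ : (Fin m → ℤ) → ℤ → ℤ → ℂ} (hκ : ∀ x t s, ‖κ x t s‖ ≤ 1)
    (hκ' : ∀ x t s, κ x t s ≠ 0 → g * (s + l (toR x)) ^ 2 ≤
      g * (t + l (toR x)) ^ 2 - |g| * (|(t - s : ℝ)| ^ 2 - |(t - s : ℝ)|))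
    {a : (Fin (m + 1) → ℤ) → ℂ} (ha : a ∈ coeffSpace b) :
    (∀ x t, Summable fun s => κ x t s * a (snocZ x s)) ∧
    (fun y : Fin (m + 1) → ℤ => ∑' s : ℤ, κ (Fin.init y) (y (Fin.last m)) s *
      a (snocZ (Fin.init y) s)) ∈ coeffSpace b := by
  have key : ∀ R : ℝ, ∃ C : ℝ, ∀ x t s, ‖κ x t s * a (snocZ x s)‖ ≤
      C * Real.exp (Real.pi * b (toR (snocZ x t)) (toR (snocZ x t)) - R * norm₁ (snocZ x t)) *
        Real.exp (-|((t - s : ℤ) : ℝ)|) := by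
    intro R
    obtain ⟨K, hK⟩ := exists_exponent_bound hg R
    obtain ⟨C, hC⟩ := ha R
    have hC0 := nonneg_of_coeff_bound hC
    refine ⟨C * Real.exp K, fun x t s => ?_⟩
    by_cases h : κ x t s = 0
    · rw [h, zero_mul, norm_zero]
      positivity
    · have h1 := hK s t _ (hκ' x t s h)
      rw [norm_mul]
      refine (mul_le_of_le_one_left (norm_nonneg _) (hκ x t s)).trans ((hC _).trans ?_)
      rw [mul_assoc, mul_assoc, ← Real.exp_add, ← Real.exp_add]
      refine mul_le_mul_of_nonneg_left (Real.exp_le_exp.2 ?_) hC0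
      rw [form_snoc hbb, form_snoc hbb, norm₁_snoc, norm₁_snoc, Int.cast_sub]
      linarith
  have hsum : ∀ t : ℤ, Summable fun s : ℤ => Real.exp (-|((t - s : ℤ) : ℝ)|) := fun t =>
    (Equiv.subLeft t).summable_iff.2 summable_exp_neg_abs
  have htsum : ∀ t : ℤ, ∑' s : ℤ, Real.exp (-|((t - s : ℤ) : ℝ)|) =
      ∑' d : ℤ, Real.exp (-|(d : ℝ)|) := fun t =>
    (Equiv.subLeft t).tsum_eq fun d : ℤ => Real.exp (-|(d : ℝ)|)
  constructor
  · intro x t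
    obtain ⟨C, hC⟩ := key 0
    exact Summable.of_norm_bounded ((hsum t).mul_left _) (hC x t)
  · intro R
    obtain ⟨C, hC⟩ := key R
    refine ⟨C * ∑' d : ℤ, Real.exp (-|(d : ℝ)|), forall_snoc.2 fun x t => ?_⟩
    simp only [Fin.init_snoc, Fin.snoc_last]
    have h1 := tsum_of_norm_bounded ((hsum t).mul_left _).hasSum (hC x t)
    rw [tsum_mul_left, htsum] at h1
    refine h1.trans_eq ?_
    ring

theorem sq_bound_of_between {T s t : ℤ} {lam : ℝ} (hT : |(T : ℝ) + lam| ≤ 1 / 2)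
    (h : T < s ∧ s ≤ t ∨ t < s ∧ s ≤ T) :
    ((s : ℝ) + lam) ^ 2 ≤ (t + lam) ^ 2 - (|(t - s : ℝ)| ^ 2 - |(t - s : ℝ)|) := by
  obtain ⟨h1, h2⟩ := abs_le.1 hT
  rw [sq_abs]
  rcases h with ⟨h3, h4⟩ | ⟨h3, h4⟩
  · have h3' : (T : ℝ) + 1 ≤ s := by exact_mod_cast h3
    have h4' : (s : ℝ) ≤ t := by exact_mod_cast h4
    rw [abs_of_nonneg (by linarith)]
    nlinarith
  · have h3' : (t : ℝ) + 1 ≤ s := by exact_mod_cast h3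
    have h4' : (s : ℝ) ≤ T := by exact_mod_cast h4
    rw [abs_of_nonpos (by linarith)]
    nlinarith

theorem sq_bound_of_beyond {T s t : ℤ} {lam : ℝ} (hT : |(T : ℝ) + lam| ≤ 1 / 2)
    (h : T ≤ t ∧ t < s ∨ t < T ∧ s ≤ t) :
    ((t : ℝ) + lam) ^ 2 + (|(t - s : ℝ)| ^ 2 - |(t - s : ℝ)|) ≤ (s + lam) ^ 2 := by
  obtain ⟨h1, h2⟩ := abs_le.1 hT
  rw [sq_abs]
  rcases h with ⟨h3, h4⟩ | ⟨h3, h4⟩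
  · have h3' : (T : ℝ) ≤ t := by exact_mod_cast h3
    have h4' : (t : ℝ) + 1 ≤ s := by exact_mod_cast h4
    rw [abs_of_nonpos (by linarith)]
    nlinarith
  · have h3' : (t : ℝ) + 1 ≤ T := by exact_mod_cast h3
    have h4' : (s : ℝ) ≤ t := by exact_mod_cast h4
    rw [abs_of_nonneg (by linarith)]
    nlinarith

/-- The kernel which sums between `T` and `t`, with orientation. -/
def betweenKernel (T t s : ℤ) : ℂ :=
  if T < s ∧ s ≤ t then -1 else if t < s ∧ s ≤ T then 1 else 0

/-- The kernel which at `t` sums over the places beyond `t`, seen from `T`. -/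
def beyondKernel (T t s : ℤ) : ℂ :=
  if T ≤ t then if t < s then 1 else 0 else if s ≤ t then -1 else 0

theorem betweenKernel_sub (T t s : ℤ) :
    betweenKernel T (t - 1) s - betweenKernel T t s = if s = t then 1 else 0 := by
  unfold betweenKernel
  split_ifs <;> first | lia | simp

theorem beyondKernel_sub (T t s : ℤ) :
    beyondKernel T (t - 1) s - beyondKernel T t s =
      (if s = t then 1 else 0) - if t = T then 1 else 0 := by
  unfold beyondKernel
  split_ifs <;> first | lia | simp

theorem norm_betweenKernel_le (T t s : ℤ) : ‖betweenKernel T t s‖ ≤ 1 := by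
  unfold betweenKernel
  split_ifs <;> simp

theorem norm_beyondKernel_le (T t s : ℤ) : ‖beyondKernel T t s‖ ≤ 1 := by
  unfold beyondKernel
  split_ifs <;> simp

theorem between_of_kernel_ne_zero {T t s : ℤ} (h : betweenKernel T t s ≠ 0) :
    T < s ∧ s ≤ t ∨ t < s ∧ s ≤ T := by
  unfold betweenKernel at h
  split_ifs at h with h1 h2
  · exact Or.inl h1
  · exact Or.inr h2
  · exact absurd rfl h

theorem beyond_of_kernel_ne_zero {T t s : ℤ} (h : beyondKernel T t s ≠ 0) :
    T ≤ t ∧ t < s ∨ t < T ∧ s ≤ t := by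
  unfold beyondKernel at h
  split_ifs at h with h1 h2 h3
  · exact Or.inl ⟨h1, h2⟩
  · exact absurd rfl h
  · exact Or.inr ⟨not_le.1 h1, h3⟩
  · exact absurd rfl h

variable {n : ℕ}

theorem coeffDiff_last_apply (hm : m < n) (a : coeffSpace b) (x : Fin m → ℤ) (t : ℤ) :
    (coeffDiff b (Sum.inlₗ ⟨m, hm⟩ : Dir n) a).1 (snocZ x t) =
      a.1 (snocZ x (t - 1)) - a.1 (snocZ x t) := by
  rw [coeffDiff_inl_apply, snoc_sub_unitAt_last]

theorem coeffDiff_of_lt_apply {j : Fin n} (hj : (j : ℕ) < m) (a : coeffSpace b) (x : Fin m → ℤ)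
    (t : ℤ) : (coeffDiff b (Sum.inlₗ j : Dir n) a).1 (snocZ x t) =
      a.1 (snocZ (x - unitAt m j) t) - a.1 (snocZ x t) := by
  rw [coeffDiff_inl_apply, snoc_sub_unitAt_of_lt x t hj]

/-- In a positive direction the difference operator is surjective. -/
theorem coeffDiff_surjective (hm : m < n) (hg : 0 < g)
    (hbb : CompletesSquare b b' g l) :
    Function.Surjective (coeffDiff b (Sum.inlₗ ⟨m, hm⟩ : Dir n)) := by
  intro a
  obtain ⟨hs, hmem⟩ := kernel_sum_bound hg.ne' hbb
    (κ := fun x t s => betweenKernel (vertex l x) t s) (fun x t s => norm_betweenKernel_le _ _ _)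
    (fun x t s h => by
      have := sq_bound_of_between (abs_vertex_add_le l x) (between_of_kernel_ne_zero h)
      rw [abs_of_pos hg]
      nlinarith) a.2
  refine ⟨⟨_, hmem⟩, Subtype.ext (funext (forall_snoc.2 fun x t => ?_))⟩
  rw [coeffDiff_last_apply]
  simp only [Fin.init_snoc, Fin.snoc_last]
  rw [← (hs x _).tsum_sub (hs x _)]
  simp only [← sub_mul, betweenKernel_sub, ite_mul, one_mul, zero_mul]
  exact tsum_ite_eq t _

/-- The function on `ℤᵐ⁺¹` which does not depend on the last coordinate. -/
def coeffPullback (hg : 0 < g)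
    (hbb : CompletesSquare b b' g l) : coeffSpace b' →ₗ[ℂ] coeffSpace b where
  toFun a := ⟨fun y => a.1 (Fin.init y), fun R => by
    obtain ⟨L, hL0, hL⟩ := exists_abs_le_norm₁ l
    obtain ⟨C, hC⟩ := a.2 (|R| * (1 + L))
    have hC0 := nonneg_of_coeff_bound hC
    refine ⟨C * Real.exp (R ^ 2 / (4 * (Real.pi * g))), forall_snoc.2 fun x t => ?_⟩
    simp only [Fin.init_snoc]
    refine (hC x).trans ?_
    rw [mul_assoc C, ← Real.exp_add]
    refine mul_le_mul_of_nonneg_left (Real.exp_le_exp.2 ?_) hC0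
    rw [form_snoc hbb, norm₁_snoc]
    set σ := (t : ℝ) + l (toR x) with hσ
    have h1 : |(t : ℝ)| ≤ |σ| + L * norm₁ x := by
      have h2 : (t : ℝ) = σ - l (toR x) := by rw [hσ]; ring
      rw [h2]
      exact (abs_sub _ _).trans (add_le_add_right (hL x) _)
    have h3 : |R| * |σ| ≤ R ^ 2 / (4 * (Real.pi * g)) + Real.pi * g * σ ^ 2 := by
      have hpg : 0 < Real.pi * g := mul_pos Real.pi_pos hg
      have h4 : 0 ≤ (|R| - 2 * (Real.pi * g) * |σ|) ^ 2 / (4 * (Real.pi * g)) := by positivity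
      have h5 : (|R| - 2 * (Real.pi * g) * |σ|) ^ 2 / (4 * (Real.pi * g)) =
          |R| ^ 2 / (4 * (Real.pi * g)) - |R| * |σ| + Real.pi * g * |σ| ^ 2 := by
        field_simp
        ring
      rw [sq_abs, sq_abs] at h5
      linarith
    have h6 := mul_le_mul_of_nonneg_left h1 (abs_nonneg R)
    have h7 := mul_le_mul_of_nonneg_right (le_abs_self R)
      (add_nonneg (norm₁_nonneg x) (abs_nonneg (t : ℝ)))
    nlinarith⟩
  map_add' _ _ := rfl
  map_smul' _ _ := rfl

theorem coeffPullback_snoc (hg : 0 < g)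
    (hbb : CompletesSquare b b' g l) (a : coeffSpace b') (x : Fin m → ℤ) (t : ℤ) :
    (coeffPullback hg hbb a).1 (snocZ x t) = a.1 x := by
  change a.1 (Fin.init (snocZ x t)) = _
  rw [Fin.init_snoc]

/-- A function annihilated by the difference operator in the last direction does not depend on the
last coordinate. -/
theorem eq_of_coeffDiff_last_eq_zero (hm : m < n) {a : coeffSpace b}
    (ha : coeffDiff b (Sum.inlₗ ⟨m, hm⟩ : Dir n) a = 0) (x : Fin m → ℤ) (t : ℤ) :
    a.1 (snocZ x t) = a.1 (snocZ x 0) := by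
  have hper : Function.Periodic (fun t : ℤ => a.1 (snocZ x t)) 1 := fun t => by
    have h := coeffDiff_last_apply hm a x (t + 1)
    rw [ha, add_sub_cancel_right] at h
    exact (sub_eq_zero.1 h.symm).symm
  have := hper.int_mul_eq t
  simpa using this

/-- In a positive direction the kernel of the difference operator is the coefficient space of the
form obtained by completing the square. -/
theorem exists_coeffPullback_eq (hm : m < n) (hg : 0 < g)
    (hbb : CompletesSquare b b' g l) {a : coeffSpace b}
    (ha : coeffDiff b (Sum.inlₗ ⟨m, hm⟩ : Dir n) a = 0) : ∃ a', coeffPullback hg hbb a' = a := by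
  have hconst := eq_of_coeffDiff_last_eq_zero hm ha
  refine ⟨⟨fun x => a.1 (snocZ x 0), fun R => ?_⟩,
    Subtype.ext (funext (forall_snoc.2 fun x t => ?_))⟩
  · obtain ⟨C, hC⟩ := a.2 |R|
    have hC0 := nonneg_of_coeff_bound hC
    refine ⟨C * Real.exp (Real.pi * g), fun x => ?_⟩
    -- the value at the vertex, where the weight is smallest
    change ‖a.1 (snocZ x 0)‖ ≤ _
    rw [← hconst x (vertex l x)]
    refine (hC _).trans ?_
    rw [mul_assoc C, ← Real.exp_add]
    refine mul_le_mul_of_nonneg_left (Real.exp_le_exp.2 ?_) hC0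
    rw [form_snoc hbb, norm₁_snoc]
    have h1 : ((vertex l x : ℝ) + l (toR x)) ^ 2 ≤ 1 := by
      rw [← sq_abs]
      have := abs_vertex_add_le l x
      nlinarith [abs_nonneg ((vertex l x : ℝ) + l (toR x))]
    have h2 := mul_le_mul_of_nonneg_left h1 (mul_pos Real.pi_pos hg).le
    have h3 := mul_nonneg (abs_nonneg R) (abs_nonneg (vertex l x : ℝ))
    have h4 := mul_le_mul_of_nonneg_right (le_abs_self R) (norm₁_nonneg x)
    nlinarith
  · rw [coeffPullback_snoc]
    exact (hconst x t).symm

theorem coeffDiff_coeffPullback {j : Fin n} (hj : (j : ℕ) < m) (hg : 0 < g)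
    (hbb : CompletesSquare b b' g l) (a : coeffSpace b') :
    coeffDiff b (Sum.inlₗ j : Dir n) (coeffPullback hg hbb a) =
      coeffPullback hg hbb (coeffDiff b' (Sum.inlₗ j : Dir n) a) := by
  refine Subtype.ext (funext (forall_snoc.2 fun x t => ?_))
  rw [coeffDiff_of_lt_apply hj, coeffPullback_snoc, coeffPullback_snoc, coeffPullback_snoc,
    coeffDiff_inl_apply]

theorem coeffDiff_last_coeffPullback (hm : m < n) (hg : 0 < g)
    (hbb : CompletesSquare b b' g l) (a : coeffSpace b') :
    coeffDiff b (Sum.inlₗ ⟨m, hm⟩ : Dir n) (coeffPullback hg hbb a) = 0 := by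
  refine Subtype.ext (funext (forall_snoc.2 fun x t => ?_))
  rw [coeffDiff_last_apply, coeffPullback_snoc, coeffPullback_snoc, sub_self]
  rfl

/-- In a negative direction the functions decay along the lines in that direction. -/
theorem exists_bound_of_neg (hg : g < 0)
    (hbb : CompletesSquare b b' g l) (a : coeffSpace b) (R : ℝ) :
    ∃ C : ℝ, ∀ x t, ‖a.1 (snocZ x t)‖ ≤
      C * Real.exp (Real.pi * b' (toR x) (toR x) - R * norm₁ x) * Real.exp (-|(t : ℝ)|) := by
  obtain ⟨C, hC⟩ := a.2 (max R 1)
  have hC0 := nonneg_of_coeff_bound hC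
  refine ⟨C, fun x t => (hC _).trans ?_⟩
  rw [mul_assoc C, ← Real.exp_add]
  refine mul_le_mul_of_nonneg_left (Real.exp_le_exp.2 ?_) hC0
  rw [form_snoc hbb, norm₁_snoc]
  have h1 : Real.pi * (g * (t + l (toR x)) ^ 2) ≤ 0 :=
    mul_nonpos_of_nonneg_of_nonpos Real.pi_pos.le
      (mul_nonpos_of_nonpos_of_nonneg hg.le (sq_nonneg _))
  have h2 := mul_le_mul_of_nonneg_right (le_max_left R 1) (norm₁_nonneg x)
  have h3 := mul_le_mul_of_nonneg_right (le_max_right R 1) (abs_nonneg (t : ℝ))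
  linarith

theorem summable_snoc_of_neg (hg : g < 0)
    (hbb : CompletesSquare b b' g l) (a : coeffSpace b) (x : Fin m → ℤ) :
    Summable fun t => a.1 (snocZ x t) := by
  obtain ⟨C, hC⟩ := exists_bound_of_neg hg hbb a 0
  exact Summable.of_norm_bounded (summable_exp_neg_abs.mul_left _) (hC x)

/-- Summation over the last coordinate. -/
def coeffSum (hg : g < 0)
    (hbb : CompletesSquare b b' g l) : coeffSpace b →ₗ[ℂ] coeffSpace b' where
  toFun a := ⟨fun x => ∑' t, a.1 (snocZ x t), fun R => by
    obtain ⟨C, hC⟩ := exists_bound_of_neg hg hbb a R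
    refine ⟨C * ∑' d : ℤ, Real.exp (-|(d : ℝ)|), fun x => ?_⟩
    have h1 := tsum_of_norm_bounded (summable_exp_neg_abs.mul_left _).hasSum (hC x)
    rw [tsum_mul_left] at h1
    refine h1.trans_eq ?_
    ring⟩
  map_add' a a' := Subtype.ext <| funext fun x =>
    (summable_snoc_of_neg hg hbb a x).tsum_add (summable_snoc_of_neg hg hbb a' x)
  map_smul' c a := Subtype.ext <| funext fun x =>
    (summable_snoc_of_neg hg hbb a x).tsum_const_smul c

theorem coeffSum_apply (hg : g < 0)
    (hbb : CompletesSquare b b' g l) (a : coeffSpace b) (x : Fin m → ℤ) :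
    (coeffSum hg hbb a).1 x = ∑' t, a.1 (snocZ x t) := rfl

theorem coeffDiff_coeffSum {j : Fin n} (hj : (j : ℕ) < m) (hg : g < 0)
    (hbb : CompletesSquare b b' g l) (a : coeffSpace b) :
    coeffDiff b' (Sum.inlₗ j : Dir n) (coeffSum hg hbb a) =
      coeffSum hg hbb (coeffDiff b (Sum.inlₗ j : Dir n) a) := by
  refine Subtype.ext (funext fun x => ?_)
  rw [coeffDiff_inl_apply, coeffSum_apply, coeffSum_apply, coeffSum_apply,
    ← (summable_snoc_of_neg hg hbb a _).tsum_sub (summable_snoc_of_neg hg hbb a _)]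
  exact tsum_congr fun t => (coeffDiff_of_lt_apply hj a x t).symm

theorem coeffSum_coeffDiff_last (hm : m < n) (hg : g < 0)
    (hbb : CompletesSquare b b' g l) (a : coeffSpace b) :
    coeffSum hg hbb (coeffDiff b (Sum.inlₗ ⟨m, hm⟩ : Dir n) a) = 0 := by
  refine Subtype.ext (funext fun x => ?_)
  have hs := summable_snoc_of_neg hg hbb a x
  have hs' : Summable fun t => a.1 (snocZ x (t - 1)) := (Equiv.subRight (1 : ℤ)).summable_iff.2 hs
  rw [coeffSum_apply]
  simp only [coeffDiff_last_apply]
  rw [hs'.tsum_sub hs, sub_eq_zero.2]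
  · rfl
  · exact (Equiv.subRight (1 : ℤ)).tsum_eq fun t => a.1 (snocZ x t)

/-- In a negative direction the difference operator is injective. -/
theorem coeffDiff_injective (hm : m < n) (hg : g < 0)
    (hbb : CompletesSquare b b' g l) :
    Function.Injective (coeffDiff b (Sum.inlₗ ⟨m, hm⟩ : Dir n)) := by
  rw [injective_iff_map_eq_zero]
  intro a ha
  refine Subtype.ext (funext (forall_snoc.2 fun x t => ?_))
  have h := summable_snoc_of_neg hg hbb a x
  simp only [eq_of_coeffDiff_last_eq_zero hm ha x] at h
  rw [eq_of_coeffDiff_last_eq_zero hm ha x t]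
  exact (summable_const_iff _).1 h

/-- In a negative direction the sums over the last coordinate detect the image of the difference
operator. -/
theorem exists_coeffDiff_eq (hm : m < n) (hg : g < 0)
    (hbb : CompletesSquare b b' g l) {a : coeffSpace b} (ha : coeffSum hg hbb a = 0) :
    ∃ a', coeffDiff b (Sum.inlₗ ⟨m, hm⟩ : Dir n) a' = a := by
  obtain ⟨hs, hmem⟩ := kernel_sum_bound hg.ne hbb
    (κ := fun x t s => beyondKernel (vertex l x) t s) (fun x t s => norm_beyondKernel_le _ _ _)
    (fun x t s h => by
      have := sq_bound_of_beyond (abs_vertex_add_le l x) (beyond_of_kernel_ne_zero h)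
      rw [abs_of_neg hg]
      nlinarith) a.2
  refine ⟨⟨_, hmem⟩, Subtype.ext (funext (forall_snoc.2 fun x t => ?_))⟩
  have hsum : ∑' s, a.1 (snocZ x s) = 0 := congrFun (congrArg Subtype.val ha) x
  have hsx := summable_snoc_of_neg hg hbb a x
  rw [coeffDiff_last_apply]
  simp only [Fin.init_snoc, Fin.snoc_last]
  rw [← (hs x _).tsum_sub (hs x _)]
  simp only [← sub_mul, beyondKernel_sub]
  simp only [sub_mul]
  have h1 : Summable fun s => (if s = t then (1 : ℂ) else 0) * a.1 (snocZ x s) :=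
    summable_of_ne_finset_zero (s := {t}) fun s hs => by
      rw [if_neg (by simpa using hs), zero_mul]
  rw [h1.tsum_sub (hsx.mul_left _), tsum_mul_left, hsum, mul_zero, sub_zero]
  simp only [ite_mul, one_mul, zero_mul]
  exact tsum_ite_eq t _

/-- In a negative direction every function arises by summation: put its values at the vertices. -/
theorem coeffSum_surjective (hg : g < 0)
    (hbb : CompletesSquare b b' g l) : Function.Surjective (coeffSum hg hbb) := by
  intro a
  refine ⟨⟨fun y => if y (Fin.last m) = vertex l (Fin.init y) then a.1 (Fin.init y) else 0,
    fun R => ?_⟩, Subtype.ext (funext fun x => ?_)⟩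
  · obtain ⟨L, hL0, hL⟩ := exists_abs_le_norm₁ l
    obtain ⟨C, hC⟩ := a.2 (|R| * (1 + L))
    have hC0 := nonneg_of_coeff_bound hC
    refine ⟨C * Real.exp (|R| - Real.pi * g), forall_snoc.2 fun x t => ?_⟩
    simp only [Fin.init_snoc, Fin.snoc_last]
    split_ifs with ht
    · refine (hC x).trans ?_
      rw [mul_assoc C, ← Real.exp_add]
      refine mul_le_mul_of_nonneg_left (Real.exp_le_exp.2 ?_) hC0
      rw [form_snoc hbb, norm₁_snoc]
      have h0 := abs_vertex_add_le l x
      rw [← ht] at h0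
      set σ := (t : ℝ) + l (toR x) with hσ
      have h1 : |(t : ℝ)| ≤ 1 + L * norm₁ x := by
        have h2 : (t : ℝ) = σ - l (toR x) := by rw [hσ]; ring
        rw [h2]
        have := abs_sub σ (l (toR x))
        linarith [hL x]
      have h3 : σ ^ 2 ≤ 1 := by
        rw [← sq_abs]
        nlinarith [abs_nonneg σ]
      have h4 := mul_le_mul_of_nonneg_left h3
        (mul_pos Real.pi_pos (neg_pos.2 hg)).le
      have h6 := mul_le_mul_of_nonneg_left h1 (abs_nonneg R)
      have h7 := mul_le_mul_of_nonneg_right (le_abs_self R)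
        (add_nonneg (norm₁_nonneg x) (abs_nonneg (t : ℝ)))
      nlinarith
    · rw [norm_zero]
      positivity
  · rw [coeffSum_apply]
    simp only [Fin.init_snoc, Fin.snoc_last]
    exact tsum_ite_eq _ _

end Elimination

/-! ### Cohomology of the coefficient spaces -/

section CoefficientCohomology

variable {n : ℕ}

theorem topIndex_succ {m : ℕ} (hm : m < n) :
    topIndex n (m + 1) = insert (Sum.inlₗ ⟨m, hm⟩) (topIndex n m) := by
  ext p
  simp only [topIndex, Finset.mem_filter, Finset.mem_univ, true_and, Finset.mem_insert]
  constructor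
  · rintro ⟨j, hj, rfl⟩
    rcases (Nat.lt_succ_iff.1 hj).eq_or_lt with h | h
    · exact Or.inl (congrArg _ (Fin.ext h))
    · exact Or.inr ⟨j, h, rfl⟩
  · rintro (rfl | ⟨j, hj, rfl⟩)
    · exact ⟨_, Nat.lt_succ_self m, rfl⟩
    · exact ⟨j, hj.trans (Nat.lt_succ_self m), rfl⟩

theorem topIndex_mono : Monotone (topIndex n) := fun _ _ h p hp => by
  simp only [topIndex, Finset.mem_filter, Finset.mem_univ, true_and] at hp ⊢
  obtain ⟨j, hj, rfl⟩ := hp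
  exact ⟨j, hj.trans_le h, rfl⟩

theorem topIndex_zero : topIndex n 0 = ∅ := by
  simp [topIndex]

theorem card_topIndex {k : ℕ} (hk : k ≤ n) : (topIndex n k).card = k := by
  induction k with
  | zero => simp [topIndex_zero]
  | succ k ih =>
    rw [topIndex_succ hk, Finset.card_insert_of_notMem, ih (Nat.le_of_succ_le hk)]
    simp [topIndex, Sum.inlₗ]

/-- The indicator function of the integral vectors with vanishing coordinates below `k`. -/
def tailIndicator (m k : ℕ) (x : Fin m → ℤ) : ℂ :=
  if ∀ i : Fin m, (i : ℕ) < k → x i = 0 then 1 else 0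

theorem tailIndicator_snoc_of_le {m k : ℕ} (hk : k ≤ m) (x : Fin m → ℤ) (t : ℤ) :
    tailIndicator (m + 1) k (snocZ x t) = tailIndicator m k x := by
  simp [tailIndicator, Fin.forall_fin_succ', hk]

theorem tailIndicator_snoc_of_lt {m k : ℕ} (hk : m < k) (x : Fin m → ℤ) (t : ℤ) :
    tailIndicator (m + 1) k (snocZ x t) = if t = 0 then tailIndicator m k x else 0 := by
  simp only [tailIndicator, Fin.forall_fin_succ', Fin.snoc_castSucc, Fin.snoc_last,
    Fin.val_castSucc, Fin.val_last, hk, forall_const]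
  split_ifs <;> tauto

/-- The Koszul cohomology of the difference operators on the coefficient space of a split form: a
line in degree `k`, spanned by the indicator function of the positive directions. -/
theorem koszulLine_coeffDiff (k m : ℕ) (hm : m ≤ n) (b : LinearMap.BilinForm ℝ (Fin m → ℝ))
    (hb : IsSplitForm k b) :
    ∃ a : coeffSpace b, (∀ x, a.1 x = tailIndicator m k x) ∧
      KoszulLine (coeffDiff (n := n) b) (topIndex n m) (topIndex n (min k m)) a := by
  induction m with
  | zero =>
    have hmem : tailIndicator 0 k ∈ coeffSpace b := fun R => ⟨1, fun x => by
      have h : b (toR x) (toR x) = 0 := by rw [Subsingleton.elim (toR x) 0, map_zero]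
      simp [tailIndicator, norm₁, h]⟩
    refine ⟨⟨_, hmem⟩, fun _ => rfl, ?_⟩
    rw [Nat.min_zero, topIndex_zero]
    refine KoszulLine.empty _ (fun h => ?_) fun a => ⟨a.1 0, Subtype.ext (funext fun x => ?_)⟩
    · have := congrFun (congrArg Subtype.val h) 0
      simp [tailIndicator] at this
    · rw [Subsingleton.elim x 0]
      simp [tailIndicator]
  | succ m ih =>
    have hm' : m < n := hm
    obtain ⟨b', g, l, hb', hpos, hneg, hbb⟩ := hb.exists_schur
    obtain ⟨a', ha', hline⟩ := ih hm'.le b' hb'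
    have hlt : ∀ q ∈ topIndex n m, q < Sum.inlₗ ⟨m, hm'⟩ := fun q hq => by
      simp only [topIndex, Finset.mem_filter, Finset.mem_univ, true_and] at hq
      obtain ⟨j, hj, rfl⟩ := hq
      exact Sum.Lex.inl_lt_inl_iff.2 hj
    have hcases : ∀ q ∈ topIndex n m, ∃ j : Fin n, (j : ℕ) < m ∧ q = Sum.inlₗ j := fun q hq => by
      simpa [topIndex] using hq
    rw [topIndex_succ hm']
    rcases le_or_gt k m with hk | hk
    · have hg := hpos hk
      refine ⟨coeffPullback hg hbb a', forall_snoc.2 fun x t => ?_, ?_⟩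
      · rw [coeffPullback_snoc, ha', tailIndicator_snoc_of_le hk]
      · rw [min_eq_left (hk.trans (Nat.le_succ m))]
        rw [min_eq_left hk] at hline
        refine KoszulLine.of_surjective (A := coeffSpace b) (A' := coeffSpace b')
          (fun p q a => coeffDiff_comm p q a) (coeffPullback hg hbb) hlt (topIndex_mono hk)
          (fun q hq a => ?_) (fun a₁ a₂ h => Subtype.ext (funext fun x => ?_))
          (fun a ha => exists_coeffPullback_eq hm' hg hbb ha)
          (fun a => coeffDiff_last_coeffPullback hm' hg hbb a)
          (coeffDiff_surjective hm' hg hbb) hline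
        · obtain ⟨j, hj, rfl⟩ := hcases q hq
          exact coeffDiff_coeffPullback hj hg hbb a
        · rw [← coeffPullback_snoc hg hbb a₁ x 0, h, coeffPullback_snoc]
    · have hg := hneg hk
      have hmem : tailIndicator (m + 1) k ∈ coeffSpace b := fun R => by
        refine ⟨1, fun x => ?_⟩
        by_cases hx : x = 0
        · rw [hx]
          have : toR (0 : Fin (m + 1) → ℤ) = 0 := by funext i; simp [toR]
          simp [tailIndicator, norm₁, this]
        · rw [tailIndicator, if_neg, norm_zero]
          · positivity
          · exact fun h => hx (funext fun i => h i (by have := i.2; lia))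
      refine ⟨⟨_, hmem⟩, fun _ => rfl, ?_⟩
      rw [min_eq_right (Nat.succ_le_of_lt hk), topIndex_succ hm']
      rw [min_eq_right hk.le] at hline
      refine KoszulLine.of_injective (A := coeffSpace b) (A' := coeffSpace b')
        (D' := coeffDiff b')
        (fun p q a => coeffDiff_comm p q a) (coeffSum hg hbb) hlt (fun q hq a => ?_)
        (coeffSum_surjective hg hbb) (fun a ha => exists_coeffDiff_eq hm' hg hbb ha)
        (fun a => coeffSum_coeffDiff_last hm' hg hbb a) (coeffDiff_injective hm' hg hbb) ?_
      · obtain ⟨j, hj, rfl⟩ := hcases q hq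
        exact coeffDiff_coeffSum hj hg hbb a
      · have : coeffSum hg hbb ⟨_, hmem⟩ = a' := by
          refine Subtype.ext (funext fun x => ?_)
          rw [coeffSum_apply, ha']
          simp only [tailIndicator_snoc_of_lt hk]
          exact tsum_ite_eq _ _
        rw [this]
        exact hline

end CoefficientCohomology

/-! ### Fourier series of entire periodic functions -/

section FourierSeries

open MeasureTheory

variable {n : ℕ}

theorem summable_exp_neg_norm₁ : Summable fun x : Fin n → ℤ => Real.exp (-norm₁ x) := by
  induction n with
  | zero => exact Summable.of_finite
  | succ n ih =>
    rw [← (Fin.snocEquiv fun _ : Fin (n + 1) => ℤ).summable_iff]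
    have h := summable_exp_neg_abs.mul_of_nonneg ih (fun _ => (Real.exp_pos _).le)
      (fun _ => (Real.exp_pos _).le)
    refine h.congr fun p => ?_
    change _ = Real.exp (-norm₁ (snocZ p.2 p.1))
    rw [norm₁_snoc, ← Real.exp_add]
    congr 1
    ring

/-- The character `Z ↦ exp (2πi ᵗK Z)`. -/
def expChar (K : Fin n → ℤ) (Z : Fin n → ℂ) : ℂ :=
  Complex.exp (2 * Real.pi * Complex.I * (toC K ⬝ᵥ Z))

theorem expChar_add_right (K : Fin n → ℤ) (Z W : Fin n → ℂ) :
    expChar K (Z + W) = expChar K Z * expChar K W := by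
  rw [expChar, expChar, expChar, ← Complex.exp_add, dotProduct_add, mul_add]

theorem toC_add (K L : Fin n → ℤ) : toC (K + L) = toC K + toC L := by
  funext j; simp [toC]

theorem toC_neg (K : Fin n → ℤ) : toC (-K) = -toC K := by
  funext j; simp [toC]

theorem expChar_add_left (K L : Fin n → ℤ) (Z : Fin n → ℂ) :
    expChar (K + L) Z = expChar K Z * expChar L Z := by
  rw [expChar, expChar, expChar, ← Complex.exp_add, toC_add, add_dotProduct, mul_add]

theorem expChar_zero_left (Z : Fin n → ℂ) : expChar 0 Z = 1 := by
  have : toC (0 : Fin n → ℤ) = 0 := by funext j; simp [toC]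
  simp [expChar, this]

theorem expChar_zero_right (K : Fin n → ℤ) : expChar K 0 = 1 := by
  simp [expChar]

theorem expChar_neg_mul (K : Fin n → ℤ) (Z : Fin n → ℂ) : expChar (-K) Z * expChar K Z = 1 := by
  rw [← expChar_add_left, neg_add_cancel, expChar_zero_left]

theorem expChar_toC (K v : Fin n → ℤ) : expChar K (toC v) = 1 := by
  have h : toC K ⬝ᵥ toC v = ((K ⬝ᵥ v : ℤ) : ℂ) := by simp [toC, dotProduct]
  rw [expChar, h, mul_comm]
  exact Complex.exp_int_mul_two_pi_mul_I _

theorem differentiable_expChar (K : Fin n → ℤ) : Differentiable ℂ (expChar K) := by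
  unfold expChar dotProduct
  fun_prop

theorem norm_expChar (K : Fin n → ℤ) (Z : Fin n → ℂ) :
    ‖expChar K Z‖ = Real.exp (-(2 * Real.pi * ∑ i, (K i : ℝ) * (Z i).im)) := by
  rw [expChar, Complex.norm_exp]
  congr 1
  have h : (toC K ⬝ᵥ Z).im = ∑ i, (K i : ℝ) * (Z i).im := by
    simp [dotProduct, toC, Complex.im_sum]
  rw [← h]
  simp [mul_assoc]

/-- Invariance under the integral translations. -/
def IntPeriodic (h : (Fin n → ℂ) → ℂ) : Prop := ∀ (v : Fin n → ℤ) Z, h (Z + toC v) = h Z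

theorem intPeriodic_expChar (K : Fin n → ℤ) : IntPeriodic (expChar K) := fun v Z => by
  rw [expChar_add_right, expChar_toC, mul_one]

theorem IntPeriodic.mul {h h' : (Fin n → ℂ) → ℂ} (hh : IntPeriodic h) (hh' : IntPeriodic h') :
    IntPeriodic fun Z => h Z * h' Z := fun v Z => by
  simp only [hh v, hh' v]

/-- The real vector `x`, regarded as a complex one. -/
def ofRealVec (x : Fin n → ℝ) : Fin n → ℂ := fun i => (x i : ℂ)

/-- The point of the torus `ℝⁿ / ℤⁿ` with the given coordinates. -/
def toTorus (x : Fin n → ℝ) : UnitAddTorus (Fin n) := fun i => (x i : UnitAddCircle)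

theorem isOpenQuotientMap_toTorus : IsOpenQuotientMap (toTorus (n := n)) :=
  IsOpenQuotientMap.piMap fun _ => QuotientAddGroup.isOpenQuotientMap_mk

/-- Some real coordinates of a point of the torus. -/
def torusRep : UnitAddTorus (Fin n) → (Fin n → ℝ) :=
  Function.surjInv isOpenQuotientMap_toTorus.surjective

theorem exists_torusRep_eq (x : Fin n → ℝ) :
    ∃ v : Fin n → ℤ, ofRealVec (torusRep (toTorus x)) = ofRealVec x + toC v := by
  have h : toTorus (torusRep (toTorus x)) = toTorus x := Function.surjInv_eq _ _
  have h1 : ∀ i, ∃ m : ℤ, (m : ℝ) = torusRep (toTorus x) i - x i := fun i => by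
    have h2 : ((torusRep (toTorus x) i - x i : ℝ) : UnitAddCircle) = 0 := by
      rw [AddCircle.coe_sub, sub_eq_zero]
      exact congrFun h i
    obtain ⟨m, hm⟩ := (AddCircle.coe_eq_zero_iff (1 : ℝ)).1 h2
    exact ⟨m, by simpa using hm⟩
  choose v hv using h1
  refine ⟨v, funext fun i => ?_⟩
  have := hv i
  simp only [ofRealVec, toC, Pi.add_apply]
  rw [← Complex.ofReal_intCast, this]
  push_cast
  ring

/-- The restriction of a periodic function to the real torus through `Z`. -/
def onTorus (h : (Fin n → ℂ) → ℂ) (t : UnitAddTorus (Fin n)) (Z : Fin n → ℂ) : ℂ :=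
  h (ofRealVec (torusRep t) + Z)

theorem onTorus_toTorus {h : (Fin n → ℂ) → ℂ} (hh : IntPeriodic h) (x : Fin n → ℝ)
    (Z : Fin n → ℂ) : onTorus h (toTorus x) Z = h (ofRealVec x + Z) := by
  obtain ⟨v, hv⟩ := exists_torusRep_eq x
  rw [onTorus, hv, add_right_comm, hh]

theorem continuous_ofRealVec : Continuous (ofRealVec (n := n)) :=
  continuous_pi fun i => Complex.continuous_ofReal.comp (continuous_apply i)

theorem continuous_onTorus {h : (Fin n → ℂ) → ℂ} (hh : IntPeriodic h) (hc : Continuous h) :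
    Continuous (Function.uncurry (onTorus h)) := by
  rw [← (isOpenQuotientMap_toTorus.prodMap IsOpenQuotientMap.id).continuous_comp_iff]
  have : Function.uncurry (onTorus h) ∘ Prod.map toTorus id =
      fun p : (Fin n → ℝ) × (Fin n → ℂ) => h (ofRealVec p.1 + p.2) :=
    funext fun p => onTorus_toTorus hh p.1 p.2
  rw [this]
  exact hc.comp ((continuous_ofRealVec.comp continuous_fst).add continuous_snd)

theorem continuous_onTorus_left {h : (Fin n → ℂ) → ℂ} (hh : IntPeriodic h) (hc : Continuous h)
    (Z : Fin n → ℂ) : Continuous fun t => onTorus h t Z :=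
  (continuous_onTorus hh hc).comp (Continuous.prodMk_left Z)

/-- The invariant probability measure on the torus. -/
abbrev torusMeasure (n : ℕ) : Measure (UnitAddTorus (Fin n)) :=
  Measure.pi fun _ => AddCircle.haarAddCircle

/-- The mean value of a periodic function over the real torus through `Z`. -/
def torusMean (h : (Fin n → ℂ) → ℂ) (Z : Fin n → ℂ) : ℂ := ∫ t, onTorus h t Z ∂torusMeasure n

theorem torusMean_add_ofRealVec {h : (Fin n → ℂ) → ℂ} (hh : IntPeriodic h) (Z : Fin n → ℂ)
    (r : Fin n → ℝ) : torusMean h (Z + ofRealVec r) = torusMean h Z := by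
  have h1 : ∀ t, onTorus h t (Z + ofRealVec r) = onTorus h (t + toTorus r) Z := fun t => by
    obtain ⟨x, rfl⟩ := isOpenQuotientMap_toTorus.surjective t
    have h2 : toTorus x + toTorus r = toTorus (x + r) := rfl
    have h3 : ofRealVec (x + r) = ofRealVec x + ofRealVec r := by
      funext i; simp [ofRealVec]
    rw [h2, onTorus_toTorus hh, onTorus_toTorus hh, h3]
    congr 1
    abel
  simp only [torusMean, h1]
  exact integral_add_right_eq_self (μ := torusMeasure n) (fun t => onTorus h t Z) (toTorus r)

/-- Shift of contours: the mean value of an entire periodic function does not depend on the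
torus. -/
theorem torusMean_eq {h : (Fin n → ℂ) → ℂ} (hh : IntPeriodic h) (hd : Differentiable ℂ h)
    (Z W : Fin n → ℂ) : torusMean h Z = torusMean h W := by
  have hdiff : Differentiable ℂ (torusMean h) :=
    differentiable_integral_of_continuous (K := Set.univ) isCompact_univ
      (Filter.Eventually.of_forall fun _ => Set.mem_univ _)
      (continuous_onTorus hh hd.continuous) fun t => hd.comp (by fun_prop)
  refine is_const_of_fderiv_eq_zero hdiff (fun Z => ?_) Z W
  have hreal : ∀ r : Fin n → ℝ, fderiv ℂ (torusMean h) Z (ofRealVec r) = 0 := fun r => by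
    have h1 : HasDerivAt (fun s : ℝ => Z + (s : ℂ) • ofRealVec r) (ofRealVec r) 0 := by
      simpa using (Complex.ofRealCLM.hasDerivAt (x := 0)).smul_const (ofRealVec r) |>.const_add Z
    have h2 : HasFDerivAt (torusMean h) (fderiv ℂ (torusMean h) Z)
        (Z + ((0 : ℝ) : ℂ) • ofRealVec r) := by
      simpa using (hdiff Z).hasFDerivAt
    have h3 := (h2.restrictScalars ℝ).comp_hasDerivAt (0 : ℝ) h1
    have h4 : (torusMean h ∘ fun s : ℝ => Z + (s : ℂ) • ofRealVec r) =
        fun _ => torusMean h Z := funext fun s => by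
      have h5 : (s : ℂ) • ofRealVec r = ofRealVec (s • r) := by
        funext i; simp [ofRealVec]
      rw [Function.comp_apply, h5, torusMean_add_ofRealVec hh]
    rw [h4] at h3
    exact h3.unique (hasDerivAt_const _ _)
  ext1 v
  have hv : v = ofRealVec (fun i => (v i).re) + Complex.I • ofRealVec (fun i => (v i).im) := by
    funext i
    simp only [ofRealVec, Pi.add_apply, Pi.smul_apply, smul_eq_mul]
    rw [mul_comm, Complex.re_add_im]
  rw [hv, map_add, map_smul, hreal, hreal]
  simp

theorem mFourier_toTorus (K : Fin n → ℤ) (x : Fin n → ℝ) :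
    UnitAddTorus.mFourier K (toTorus x) = expChar K (ofRealVec x) := by
  simp only [UnitAddTorus.mFourier, ContinuousMap.coe_mk, toTorus, expChar, dotProduct,
    Finset.mul_sum, Complex.exp_sum]
  refine Finset.prod_congr rfl fun i _ => ?_
  rw [fourier_coe_apply]
  congr 1
  simp [toC, ofRealVec, mul_assoc]

/-- The Fourier coefficients of a periodic function. -/
def fourierMean (f : (Fin n → ℂ) → ℂ) (K : Fin n → ℤ) : ℂ :=
  torusMean (fun Z => expChar (-K) Z * f Z) 0

theorem mFourierCoeff_onTorus {f : (Fin n → ℂ) → ℂ} (hf : IntPeriodic f)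
    (hd : Differentiable ℂ f) (K : Fin n → ℤ) (Z : Fin n → ℂ) :
    UnitAddTorus.mFourierCoeff (fun t => onTorus f t Z) K = fourierMean f K * expChar K Z := by
  have hper : IntPeriodic fun Z => expChar (-K) Z * f Z := (intPeriodic_expChar _).mul hf
  rw [fourierMean, torusMean_eq hper ((differentiable_expChar _).mul hd) 0 Z]
  change ∫ t, UnitAddTorus.mFourier (-K) t • onTorus f t Z ∂torusMeasure n = _
  rw [torusMean, ← integral_mul_const]
  congr 1
  funext t
  obtain ⟨x, rfl⟩ := isOpenQuotientMap_toTorus.surjective t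
  rw [mFourier_toTorus, onTorus_toTorus hf, onTorus_toTorus hper, expChar_add_right, smul_eq_mul]
  have := expChar_neg_mul K Z
  linear_combination (-(expChar (-K) (ofRealVec x)) * f (ofRealVec x + Z)) * this

/-- The Fourier coefficients of an entire periodic function decay faster than any exponential. -/
theorem fourierMean_bound {f : (Fin n → ℂ) → ℂ} (hf : IntPeriodic f)
    (hd : Differentiable ℂ f) {R : ℝ} (hR : 0 ≤ R) :
    ∃ C : ℝ, 0 ≤ C ∧ ∀ K, ‖fourierMean f K‖ ≤ C * Real.exp (-(2 * Real.pi * R * norm₁ K)) := by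
  obtain ⟨C, hC⟩ := ((isCompact_univ (X := UnitAddTorus (Fin n))).prod
    (isCompact_closedBall (0 : Fin n → ℂ) R)).exists_bound_of_continuousOn
    (continuous_onTorus hf hd.continuous).continuousOn
  refine ⟨C, (norm_nonneg _).trans (hC (0, 0) ⟨Set.mem_univ _, Metric.mem_closedBall_self hR⟩),
    fun K => ?_⟩
  -- the torus on which the character is small
  let Z : Fin n → ℂ := fun i => ((-R * SignType.sign (K i) : ℝ) : ℂ) * Complex.I
  have hZ : Z ∈ Metric.closedBall (0 : Fin n → ℂ) R := by
    rw [mem_closedBall_zero_iff, pi_norm_le_iff_of_nonneg hR]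
    intro i
    simp only [Z, norm_mul, Complex.norm_real, Complex.norm_I, mul_one, norm_neg,
      Real.norm_eq_abs, abs_of_nonneg hR]
    refine mul_le_of_le_one_right hR ?_
    rcases lt_trichotomy (K i) 0 with h | h | h <;> simp [h]
  have hsum : ∑ i, ((-K) i : ℝ) * (Z i).im = R * norm₁ K := by
    rw [norm₁, Finset.mul_sum]
    refine Finset.sum_congr rfl fun i _ => ?_
    have him : (Z i).im = -R * SignType.sign (K i) := by
      simp only [Z, Complex.im_ofReal_mul, Complex.I_im, mul_one]
    rw [him]
    rcases lt_trichotomy (K i) 0 with h | h | h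
    · have h' : (K i : ℝ) < 0 := by exact_mod_cast h
      simp [h, abs_of_neg h']
      ring
    · simp [h]
    · have h' : (0 : ℝ) < K i := by exact_mod_cast h
      simp [h, abs_of_pos h']
      ring
  have hper : IntPeriodic fun Z => expChar (-K) Z * f Z := (intPeriodic_expChar _).mul hf
  rw [fourierMean, torusMean_eq hper ((differentiable_expChar _).mul hd) 0 Z, torusMean]
  refine (norm_integral_le_of_norm_le_const (C := C * Real.exp (-(2 * Real.pi * R * norm₁ K)))
    (Filter.Eventually.of_forall fun t => ?_)).trans (by simp)
  rw [onTorus, norm_mul, mul_comm]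
  refine mul_le_mul (hC (t, Z) ⟨Set.mem_univ _, hZ⟩) ?_ (norm_nonneg _)
    ((norm_nonneg _).trans (hC (t, Z) ⟨Set.mem_univ _, hZ⟩))
  rw [expChar_add_right, norm_mul, norm_expChar _ (ofRealVec _), norm_expChar, hsum]
  simp [ofRealVec, mul_assoc]

theorem abs_sum_mul_im_le (K : Fin n → ℤ) (Z : Fin n → ℂ) :
    |∑ i, (K i : ℝ) * (Z i).im| ≤ ‖Z‖ * norm₁ K := by
  rw [norm₁, Finset.mul_sum]
  refine (Finset.abs_sum_le_sum_abs _ _).trans (Finset.sum_le_sum fun i _ => ?_)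
  rw [abs_mul, mul_comm]
  exact mul_le_mul_of_nonneg_right ((Complex.abs_im_le_norm _).trans (norm_le_pi_norm Z i))
    (abs_nonneg _)

theorem norm_expChar_le (K : Fin n → ℤ) (Z : Fin n → ℂ) :
    ‖expChar K Z‖ ≤ Real.exp (2 * Real.pi * (‖Z‖ * norm₁ K)) := by
  rw [norm_expChar, ← mul_neg]
  refine Real.exp_le_exp.2 (mul_le_mul_of_nonneg_left ?_ Real.two_pi_pos.le)
  exact (neg_le_abs _).trans (abs_sum_mul_im_le K Z)

/-- An entire periodic function is the sum of its Fourier series on all of `ℂⁿ`. -/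
theorem hasSum_fourierMean {f : (Fin n → ℂ) → ℂ} (hf : IntPeriodic f) (hd : Differentiable ℂ f)
    (Z : Fin n → ℂ) : HasSum (fun K => fourierMean f K * expChar K Z) (f Z) := by
  have hc := continuous_onTorus_left hf hd.continuous Z
  let F : C(UnitAddTorus (Fin n), ℂ) := ⟨fun t => onTorus f t Z, hc⟩
  have hF : ∀ K, UnitAddTorus.mFourierCoeff F K = fourierMean f K * expChar K Z := fun K =>
    mFourierCoeff_onTorus hf hd K Z
  have hs : Summable (UnitAddTorus.mFourierCoeff F) := by
    obtain ⟨C, hC0, hC⟩ := fourierMean_bound hf hd (add_nonneg (norm_nonneg Z) zero_le_one)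
    refine Summable.of_norm_bounded (summable_exp_neg_norm₁.mul_left C) fun K => ?_
    rw [hF, norm_mul]
    refine (mul_le_mul (hC K) (norm_expChar_le K Z) (norm_nonneg _) (by positivity)).trans ?_
    rw [mul_assoc, ← Real.exp_add]
    refine mul_le_mul_of_nonneg_left (Real.exp_le_exp.2 ?_) hC0
    have h1 := norm₁_nonneg K
    have h2 := mul_le_mul_of_nonneg_right Real.pi_gt_three.le h1
    nlinarith
  have h := UnitAddTorus.hasSum_mFourier_series_apply_of_summable hs (toTorus 0)
  have h0 : ofRealVec (0 : Fin n → ℝ) = 0 := by funext i; simp [ofRealVec]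
  have h1 : F (toTorus 0) = f Z := by
    change onTorus f (toTorus 0) Z = _
    rw [onTorus_toTorus hf, h0, zero_add]
  simp only [hF, mFourier_toTorus, h0, expChar_zero_right, smul_eq_mul, mul_one] at h
  rwa [h1] at h

/-- Orthogonality of characters: a nontrivial character is multiplied by a constant other than `1`
when the torus is shifted, so its mean value vanishes. -/
theorem torusMean_expChar {K : Fin n → ℤ} (hK : K ≠ 0) (Z : Fin n → ℂ) :
    torusMean (expChar K) Z = 0 := by
  obtain ⟨i, hi⟩ := Function.ne_iff.1 hK
  have h1 : ∀ W, torusMean (expChar K) W = expChar K W * torusMean (expChar K) 0 := fun W => by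
    rw [torusMean, torusMean, ← integral_const_mul]
    congr 1
    funext t
    rw [onTorus, onTorus, expChar_add_right, add_zero, mul_comm]
  let W : Fin n → ℂ := Pi.single i Complex.I
  have h2 : ‖expChar K W‖ ≠ 1 := by
    rw [norm_expChar, Ne, Real.exp_eq_one_iff]
    have : ∑ j, (K j : ℝ) * (W j).im = K i := by
      rw [Finset.sum_eq_single i]
      · simp [W]
      · intro j _ hj
        simp [W, hj]
      · simp
    rw [this]
    have hi' : (K i : ℝ) ≠ 0 := by exact_mod_cast hi
    simp [Real.pi_ne_zero, hi']
  have h3 := h1 W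
  rw [torusMean_eq (intPeriodic_expChar K) (differentiable_expChar K) W 0] at h3
  have h4 : (expChar K W - 1) * torusMean (expChar K) 0 = 0 := by
    linear_combination -h3
  rcases mul_eq_zero.1 h4 with h5 | h5
  · exact absurd (by rw [sub_eq_zero.1 h5, norm_one]) h2
  · rw [torusMean_eq (intPeriodic_expChar K) (differentiable_expChar K) Z 0, h5]

theorem torusMean_one (Z : Fin n → ℂ) : torusMean (expChar (0 : Fin n → ℤ)) Z = 1 := by
  simp [torusMean, onTorus, expChar_zero_left]

/-- A Fourier series which vanishes identically on the real torus has vanishing coefficients. -/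
theorem eq_zero_of_hasSum_expChar {c : (Fin n → ℤ) → ℂ} (hc : Summable fun K => ‖c K‖)
    (h : ∀ x : Fin n → ℝ, HasSum (fun K => c K * expChar K (ofRealVec x)) 0) (K : Fin n → ℤ) :
    c K = 0 := by
  have hnorm : ∀ (L : Fin n → ℤ) (x : Fin n → ℝ), ‖expChar L (ofRealVec x)‖ = 1 := fun L x => by
    rw [norm_expChar]
    simp [ofRealVec]
  have hcont : ∀ L : Fin n → ℤ, Continuous fun t => onTorus (expChar L) t 0 := fun L =>
    continuous_onTorus_left (intPeriodic_expChar L) (differentiable_expChar L).continuous 0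
  have hint : HasSum (fun L => ∫ t, c L * onTorus (expChar (-K + L)) t 0 ∂torusMeasure n)
      (∫ t, ∑' L, c L * onTorus (expChar (-K + L)) t 0 ∂torusMeasure n) := by
    refine hasSum_integral_of_summable_integral_norm (fun L => ?_) ?_
    · refine Integrable.of_bound (continuous_const.mul (hcont _)).aestronglyMeasurable ‖c L‖
        (Filter.Eventually.of_forall fun t => ?_)
      rw [onTorus, add_zero, norm_mul, hnorm, mul_one]
    · simp only [onTorus, add_zero, norm_mul, hnorm, mul_one]
      simpa using hc
  have h0 : ∀ t, ∑' L, c L * onTorus (expChar (-K + L)) t 0 = 0 := fun t => by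
    have h1 := (h (torusRep t)).mul_left (expChar (-K) (ofRealVec (torusRep t)))
    rw [mul_zero] at h1
    rw [← h1.tsum_eq]
    refine tsum_congr fun L => ?_
    rw [onTorus, add_zero, expChar_add_left]
    ring
  simp only [h0, integral_zero, integral_const_mul] at hint
  have h2 : ∀ L, L ≠ K → c L * torusMean (expChar (-K + L)) 0 = 0 := fun L hL => by
    rw [torusMean_expChar, mul_zero]
    intro h3
    exact hL (neg_add_eq_zero.1 h3).symm
  have h3 := (hasSum_single K h2).unique hint
  rwa [neg_add_cancel, torusMean_one, mul_one] at h3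

end FourierSeries

/-! ### Signature of the lattice form -/

section Signature

variable {n : ℕ}

/-- The real vector with given coordinates in an integral basis. -/
def realVec (N : Module.Basis (Fin n) ℤ (Fin n → ℤ)) : (Fin n → ℝ) →ₗ[ℝ] (Fin n → ℝ) :=
  Fintype.linearCombination ℝ fun j => toR (N j)

theorem realVec_apply (N : Module.Basis (Fin n) ℤ (Fin n → ℤ)) (x : Fin n → ℝ) :
    realVec N x = ∑ j, x j • toR (N j) := rfl

theorem toR_sum_smul (x : Fin n → ℤ) (v : Fin n → Fin n → ℤ) :
    toR (∑ j, x j • v j) = ∑ j, (x j : ℝ) • toR (v j) := by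
  funext i
  simp [toR, Finset.sum_apply]

theorem toR_equivFun_symm (N : Module.Basis (Fin n) ℤ (Fin n → ℤ)) (x : Fin n → ℤ) :
    toR (N.equivFun.symm x) = realVec N (toR x) := by
  rw [N.equivFun_symm_apply, toR_sum_smul, realVec_apply]
  rfl

theorem realVec_surjective (N : Module.Basis (Fin n) ℤ (Fin n → ℤ)) :
    Function.Surjective (realVec N) := by
  intro y
  have h1 : ∀ i : Fin n, ∃ z, realVec N z = Pi.single i (1 : ℝ) := fun i => by
    refine ⟨toR (N.equivFun (Pi.single i 1)), ?_⟩
    rw [← toR_equivFun_symm, LinearEquiv.symm_apply_apply]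
    funext j
    simp [toR, Pi.single_apply]
  choose z hz using h1
  refine ⟨∑ i, y i • z i, ?_⟩
  simp only [map_sum, map_smul, hz]
  exact (pi_eq_sum_univ' y).symm

theorem realVec_injective (N : Module.Basis (Fin n) ℤ (Fin n → ℤ)) :
    Function.Injective (realVec N) :=
  LinearMap.injective_iff_surjective.2 (realVec_surjective N)

theorem realVec_mem_span {k : ℕ} (N : Module.Basis (Fin n) ℤ (Fin n → ℤ)) {x : Fin n → ℝ}
    (hx : ∀ i : Fin n, (i : ℕ) < k → x i = 0) :
    realVec N x ∈ Submodule.span ℝ ((fun j => toR (N j)) '' {j : Fin n | k ≤ (j : ℕ)}) := by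
  rw [realVec_apply]
  refine Submodule.sum_mem _ fun j _ => ?_
  rcases lt_or_ge (j : ℕ) k with h | h
  · rw [hx j h, zero_smul]
    exact Submodule.zero_mem _
  · exact Submodule.smul_mem _ _ (Submodule.subset_span ⟨j, h, rfl⟩)

/-- The values of a quadratic form in terms of its eigenvalues. -/
theorem dotProduct_mulVec_eq_sum_eigenvalues {Q : Matrix (Fin n) (Fin n) ℝ}
    (hQ : Q.IsHermitian) (u : Fin n → ℝ) :
    u ⬝ᵥ Q *ᵥ u = ∑ i, hQ.eigenvalues i * (u ⬝ᵥ (hQ.eigenvectorBasis i).ofLp) ^ 2 := by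
  have h1 : u = ∑ i, (u ⬝ᵥ (hQ.eigenvectorBasis i).ofLp) • (hQ.eigenvectorBasis i).ofLp := by
    have h := hQ.eigenvectorBasis.sum_repr' (WithLp.toLp 2 u)
    have h2 := congrArg WithLp.ofLp h
    rw [WithLp.ofLp_sum] at h2
    conv_lhs => rw [← WithLp.ofLp_toLp 2 u, ← h2]
    refine Finset.sum_congr rfl fun i _ => ?_
    rw [WithLp.ofLp_smul]
    congr 1
  have h2 : Q *ᵥ u = ∑ i, (u ⬝ᵥ (hQ.eigenvectorBasis i).ofLp) •
      (hQ.eigenvalues i • (hQ.eigenvectorBasis i).ofLp) := by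
    conv_lhs => rw [h1]
    rw [Matrix.mulVec_sum]
    refine Finset.sum_congr rfl fun i _ => ?_
    rw [Matrix.mulVec_smul, hQ.mulVec_eigenvectorBasis]
  rw [h2, dotProduct_sum]
  refine Finset.sum_congr rfl fun i _ => ?_
  rw [dotProduct_smul, dotProduct_smul, smul_eq_mul, smul_eq_mul]
  ring

/-- A form with `k` negative eigenvalues, counted with multiplicity, is negative on a nonzero
vector `z` which is orthogonal to a positive definite subspace of dimension `n - k`: otherwise the
form would be nonnegative on a subspace of dimension `n - k + 1`, which meets the span of the
eigenvectors of negative eigenvalues. -/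
theorem neg_of_orthogonal {k : ℕ} {Q : Matrix (Fin n) (Fin n) ℝ} (hQ : Q.IsHermitian)
    (hk : (Finset.univ.filter fun i => hQ.eigenvalues i < 0).card = k)
    {ι : Type*} [Fintype ι] (hι : n ≤ k + Fintype.card ι) {v : ι → Fin n → ℝ}
    (hv : ∀ c : ι → ℝ, c ≠ 0 → 0 < (∑ j, c j • v j) ⬝ᵥ Q *ᵥ (∑ j, c j • v j))
    {z : Fin n → ℝ} (hz : z ≠ 0) (hzv : ∀ c : ι → ℝ, z ⬝ᵥ Q *ᵥ (∑ j, c j • v j) = 0) :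
    z ⬝ᵥ Q *ᵥ z < 0 := by
  by_contra! hz0
  let vec : (Option ι → ℝ) →ₗ[ℝ] (Fin n → ℝ) :=
    Fintype.linearCombination ℝ (fun o => o.elim z v)
  have hvec : ∀ c, vec c = c none • z + ∑ j, c (some j) • v j := fun c => by
    simp [vec, Fintype.linearCombination_apply, Fintype.sum_option]
  -- the components along the eigenvectors with nonnegative eigenvalues
  let comp : (Option ι → ℝ) →ₗ[ℝ] ({i // ¬ hQ.eigenvalues i < 0} → ℝ) :=
    (Matrix.mulVecLin (Matrix.of fun i : {i // ¬ hQ.eigenvalues i < 0} =>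
      (hQ.eigenvectorBasis i.1).ofLp)).comp vec
  have hcomp : ∀ c i, comp c i = vec c ⬝ᵥ (hQ.eigenvectorBasis i.1).ofLp := fun c i => by
    simp [comp, Matrix.mulVec, dotProduct_comm]
  have hker : LinearMap.ker comp ≠ ⊥ := by
    refine LinearMap.ker_ne_bot_of_finrank_lt ?_
    rw [Module.finrank_fintype_fun_eq_card, Module.finrank_fintype_fun_eq_card,
      Fintype.card_option, Fintype.card_subtype_compl, Fintype.card_fin, Fintype.card_subtype, hk]
    lia
  obtain ⟨c, hc, hc0⟩ := (Submodule.ne_bot_iff _).1 hker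
  set u := vec c with hu
  set w := ∑ j, c (some j) • v j with hw
  have hzw : z ⬝ᵥ Q *ᵥ w = 0 := hzv fun j => c (some j)
  have hwz : w ⬝ᵥ Q *ᵥ z = 0 := by
    have hT : Qᵀ = Q := by simpa using hQ.eq
    rw [Matrix.dotProduct_mulVec, ← Matrix.mulVec_transpose, hT, dotProduct_comm, hzw]
  have hQu : u ⬝ᵥ Q *ᵥ u = c none ^ 2 * (z ⬝ᵥ Q *ᵥ z) + w ⬝ᵥ Q *ᵥ w := by
    rw [hu, hvec, ← hw]
    simp only [Matrix.mulVec_add, Matrix.mulVec_smul, dotProduct_add, add_dotProduct,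
      dotProduct_smul, smul_dotProduct, smul_eq_mul, hzw, hwz]
    ring
  have hterm : ∀ i, hQ.eigenvalues i * (u ⬝ᵥ (hQ.eigenvectorBasis i).ofLp) ^ 2 ≤ 0 := fun i => by
    by_cases hi : hQ.eigenvalues i < 0
    · exact mul_nonpos_of_nonpos_of_nonneg hi.le (sq_nonneg _)
    · have := hcomp c ⟨i, hi⟩
      rw [LinearMap.mem_ker.1 hc] at this
      rw [← this]
      simp
  have hsum := dotProduct_mulVec_eq_sum_eigenvalues hQ u
  have hle : u ⬝ᵥ Q *ᵥ u ≤ 0 := by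
    rw [hsum]
    exact Finset.sum_nonpos fun i _ => hterm i
  have hz1 : 0 ≤ c none ^ 2 * (z ⬝ᵥ Q *ᵥ z) := mul_nonneg (sq_nonneg _) hz0
  have hc1 : (fun j => c (some j)) = 0 := by
    by_contra h
    have := hv _ h
    linarith
  have hw0 : w = 0 := by
    rw [hw]
    exact Finset.sum_eq_zero fun j _ => by rw [congrFun hc1 j]; simp
  have hcn : c none ≠ 0 := fun h => hc0 <| funext fun o => by
    cases o with
    | none => exact h
    | some j => exact congrFun hc1 j
  have hu0 : u ≠ 0 := by
    rw [hu, hvec, ← hw, hw0, add_zero]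
    exact smul_ne_zero hcn hz
  -- all terms of the spectral expansion vanish, hence all components of `u`
  have hzero : ∀ i, u ⬝ᵥ (hQ.eigenvectorBasis i).ofLp = 0 := by
    have hQu0 : u ⬝ᵥ Q *ᵥ u = 0 := by
      refine le_antisymm hle ?_
      rw [hQu, hw0, zero_dotProduct, add_zero]
      exact hz1
    rw [hsum, Finset.sum_eq_zero_iff_of_nonpos fun i _ => hterm i] at hQu0
    intro i
    by_cases hi : hQ.eigenvalues i < 0
    · have := hQu0 i (Finset.mem_univ i)
      simpa [hi.ne] using this
    · rw [← hcomp c ⟨i, hi⟩, LinearMap.mem_ker.1 hc]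
      rfl
  refine hu0 ?_
  have h := hQ.eigenvectorBasis.sum_repr' (WithLp.toLp 2 u)
  have h2 : ∀ i, inner ℝ (hQ.eigenvectorBasis i) (WithLp.toLp 2 u) = 0 := fun i => hzero i
  simp only [h2, zero_smul, Finset.sum_const_zero] at h
  exact (congrArg WithLp.ofLp h).symm

/-- The bilinear form with matrix `Q` in the coordinates of a basis of the lattice. -/
def latticeForm (Q : Matrix (Fin n) (Fin n) ℝ) (N : Module.Basis (Fin n) ℤ (Fin n → ℤ)) :
    LinearMap.BilinForm ℝ (Fin n → ℝ) :=
  LinearMap.compl₁₂ (Matrix.toBilin' Q) (realVec N) (realVec N)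

theorem latticeForm_apply (Q : Matrix (Fin n) (Fin n) ℝ)
    (N : Module.Basis (Fin n) ℤ (Fin n → ℤ)) (x y : Fin n → ℝ) :
    latticeForm Q N x y = realVec N x ⬝ᵥ Q *ᵥ realVec N y :=
  Matrix.toBilin'_apply' Q (realVec N x) (realVec N y)

theorem isSplitForm_latticeForm {k : ℕ} {Q : Matrix (Fin n) (Fin n) ℝ} (hQ : Q.IsHermitian)
    (hk : (Finset.univ.filter fun i => hQ.eigenvalues i < 0).card = k)
    {N : Module.Basis (Fin n) ℤ (Fin n → ℤ)} (hN : PosDefOnTail k Q N) :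
    IsSplitForm k (latticeForm Q N) := by
  have hT : Qᵀ = Q := by simpa using hQ.eq
  have hne : ∀ x, x ≠ 0 → realVec N x ≠ 0 := fun x hx =>
    (map_ne_zero_iff _ (realVec_injective N)).2 hx
  have hpos : ∀ x, x ≠ 0 → (∀ i : Fin n, (i : ℕ) < k → x i = 0) → 0 < latticeForm Q N x x :=
    fun x hx hx' => by
      rw [latticeForm_apply]
      exact hN _ (realVec_mem_span N hx') (hne x hx)
  refine ⟨fun x y => ?_, hpos, fun x hx hx' => ?_⟩
  · rw [latticeForm_apply, latticeForm_apply, Matrix.dotProduct_mulVec,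
      ← Matrix.mulVec_transpose, hT, dotProduct_comm]
  · have hext : ∀ c : {j : Fin n // k ≤ (j : ℕ)} → ℝ, ∃ y : Fin n → ℝ,
        (∀ i : Fin n, (i : ℕ) < k → y i = 0) ∧ (∀ j, y j.1 = c j) ∧
          ∑ j, c j • toR (N j.1) = realVec N y := fun c => by
      refine ⟨fun i => if h : k ≤ (i : ℕ) then c ⟨i, h⟩ else 0,
        fun i hi => dif_neg (not_le.2 hi), fun j => dif_pos j.2, ?_⟩
      rw [realVec_apply, ← Finset.sum_subset (Finset.subset_univ
        (Finset.univ.filter fun j : Fin n => k ≤ (j : ℕ)))]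
      · rw [Finset.sum_subtype (p := fun j : Fin n => k ≤ (j : ℕ)) _ (by simp)]
        exact Finset.sum_congr rfl fun j _ => by rw [dif_pos j.2]
      · intro j _ hj
        rw [dif_neg (by simpa using hj), zero_smul]
    rw [latticeForm_apply]
    refine neg_of_orthogonal hQ hk (ι := {j : Fin n // k ≤ (j : ℕ)}) ?_
      (v := fun j => toR (N j.1)) (fun c hc => ?_) (hne x hx) fun c => ?_
    · have h1 : Fintype.card {j : Fin n // ¬ (j : ℕ) < k} =
          Fintype.card (Fin n) - Fintype.card {j : Fin n // (j : ℕ) < k} :=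
        Fintype.card_subtype_compl _
      simp only [not_lt, Fintype.card_fin] at h1
      have h2 : Fintype.card {j : Fin n // (j : ℕ) < k} ≤ k := by
        simpa using Fintype.card_le_of_injective
          (fun j : {j : Fin n // (j : ℕ) < k} => (⟨j.1, j.2⟩ : Fin k))
          fun a b h => Subtype.ext (Fin.ext (by simpa using h))
      rw [h1]
      lia
    · obtain ⟨y, hy, hyc, hsum⟩ := hext c
      rw [hsum, ← latticeForm_apply]
      refine hpos y (fun h => hc (funext fun j => ?_)) hy
      rw [← hyc, h]
      rfl
    · obtain ⟨y, hy, -, hsum⟩ := hext c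
      rw [hsum, ← latticeForm_apply]
      exact hx' y hy

end Signature

/-! ### Theta series -/

section ThetaSeries

variable {n : ℕ}

theorem norm₁_smul (c : ℤ) (x : Fin n → ℤ) : norm₁ (c • x) = |(c : ℝ)| * norm₁ x := by
  simp [norm₁, Finset.mul_sum, abs_mul]

theorem norm₁_sum_le {ι : Type*} (s : Finset ι) (v : ι → Fin n → ℤ) :
    norm₁ (∑ j ∈ s, v j) ≤ ∑ j ∈ s, norm₁ (v j) := by
  simp only [norm₁]
  rw [Finset.sum_comm]
  refine Finset.sum_le_sum fun i _ => ?_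
  rw [Finset.sum_apply, Int.cast_sum]
  exact Finset.abs_sum_le_sum_abs _ _

theorem exists_norm₁_map_le (P : (Fin n → ℤ) →ₗ[ℤ] (Fin n → ℤ)) :
    ∃ L : ℝ, 0 ≤ L ∧ ∀ x, norm₁ (P x) ≤ L * norm₁ x := by
  refine ⟨∑ i, norm₁ (P (Pi.single i 1)), Finset.sum_nonneg fun _ _ => norm₁_nonneg _,
    fun x => ?_⟩
  conv_lhs => rw [pi_eq_sum_univ' x, map_sum]
  refine (norm₁_sum_le _ _).trans ?_
  rw [norm₁, Finset.mul_sum]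
  refine Finset.sum_le_sum fun i _ => ?_
  rw [map_smul, norm₁_smul, mul_comm]
  exact mul_le_mul_of_nonneg_right (Finset.single_le_sum (f := fun i => norm₁ (P (Pi.single i 1)))
    (fun _ _ => norm₁_nonneg _) (Finset.mem_univ i)) (abs_nonneg _)

/-- The constant factor of `Θ_K`. -/
def thetaConst (Ω : Matrix (Fin n) (Fin n) ℂ) (K : Fin n → ℤ) : ℂ :=
  Complex.exp (Real.pi * Complex.I * (toC K ⬝ᵥ Ω *ᵥ toC K))

theorem Theta_eq (Ω : Matrix (Fin n) (Fin n) ℂ) (K : Fin n → ℤ) (Z : Fin n → ℂ) :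
    Theta Ω K Z = thetaConst Ω K * expChar K Z := rfl

theorem norm_thetaConst (Ω : Matrix (Fin n) (Fin n) ℂ) (K : Fin n → ℤ) :
    ‖thetaConst Ω K‖ = Real.exp (-(Real.pi * (toR K ⬝ᵥ imPart Ω *ᵥ toR K))) := by
  have h : (toC K ⬝ᵥ Ω *ᵥ toC K).im = toR K ⬝ᵥ imPart Ω *ᵥ toR K := by
    simp [dotProduct, Matrix.mulVec, toC, toR, imPart, Complex.im_sum]
  rw [thetaConst, Complex.norm_exp, ← h]
  simp [mul_assoc]

theorem Theta_add {Ω : Matrix (Fin n) (Fin n) ℂ} (hΩ : Ω.IsSymm) (K L : Fin n → ℤ)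
    (Z : Fin n → ℂ) : expChar L Z * thetaConst Ω L * Theta Ω K (Z + Ω *ᵥ toC L) =
      Theta Ω (K + L) Z := by
  have hsymm : toC L ⬝ᵥ Ω *ᵥ toC K = toC K ⬝ᵥ Ω *ᵥ toC L := by
    rw [Matrix.dotProduct_mulVec, ← Matrix.mulVec_transpose, hΩ.eq, dotProduct_comm]
  simp only [Theta, expChar, thetaConst, ← Complex.exp_add, toC_add, Matrix.mulVec_add,
    dotProduct_add, add_dotProduct, hsymm]
  congr 1
  ring

variable (Ω : Matrix (Fin n) (Fin n) ℂ) (N : Module.Basis (Fin n) ℤ (Fin n → ℤ))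

/-- In terms of the coefficients of characters, the growth condition is rapid decay. -/
theorem mem_coeffSpace_latticeForm {a : (Fin n → ℤ) → ℂ} :
    a ∈ coeffSpace (latticeForm (imPart Ω) N) ↔ ∀ R : ℝ, ∃ C : ℝ, ∀ x,
      ‖a x * thetaConst Ω (N.equivFun.symm x)‖ ≤ C * Real.exp (-(R * norm₁ x)) := by
  refine forall_congr' fun R => exists_congr fun C => forall_congr' fun x => ?_
  rw [norm_mul, norm_thetaConst, toR_equivFun_symm, ← latticeForm_apply, sub_eq_neg_add,
    Real.exp_add, Real.exp_neg (Real.pi * _), ← div_eq_mul_inv, div_le_iff₀ (Real.exp_pos _),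
    mul_assoc C]

/-- The series `∑ a_x Θ_{N x}` converges absolutely and locally uniformly. -/
theorem exists_thetaSeries_bound (a : coeffSpace (latticeForm (imPart Ω) N)) (R : ℝ) :
    ∃ u : (Fin n → ℤ) → ℝ, Summable u ∧
      ∀ x Z, ‖Z‖ ≤ R → ‖a.1 x * Theta Ω (N.equivFun.symm x) Z‖ ≤ u x := by
  obtain ⟨L, hL0, hL⟩ := exists_norm₁_map_le N.equivFun.symm.toLinearMap
  obtain ⟨C, hC⟩ := (mem_coeffSpace_latticeForm Ω N).1 a.2 (2 * Real.pi * (|R| * L) + 1)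
  have hC0 := nonneg_of_coeff_bound hC
  refine ⟨fun x => C * Real.exp (-norm₁ x), summable_exp_neg_norm₁.mul_left C, fun x Z hZ => ?_⟩
  rw [Theta_eq, ← mul_assoc, norm_mul]
  refine (mul_le_mul (hC x) (norm_expChar_le _ Z) (norm_nonneg _) (by positivity)).trans ?_
  rw [mul_assoc, ← Real.exp_add]
  refine mul_le_mul_of_nonneg_left (Real.exp_le_exp.2 ?_) hC0
  have h1 : ‖Z‖ * norm₁ (N.equivFun.symm x) ≤ |R| * (L * norm₁ x) :=
    mul_le_mul (hZ.trans (le_abs_self R)) (hL x) (norm₁_nonneg _) (abs_nonneg R)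
  have h2 := mul_le_mul_of_nonneg_left h1 Real.two_pi_pos.le
  linarith

theorem summable_thetaSeries (a : coeffSpace (latticeForm (imPart Ω) N)) (Z : Fin n → ℂ) :
    Summable fun x => a.1 x * Theta Ω (N.equivFun.symm x) Z := by
  obtain ⟨u, hu, h⟩ := exists_thetaSeries_bound Ω N a ‖Z‖
  exact Summable.of_norm_bounded hu fun x => h x Z le_rfl

variable (M : Module.Basis (Fin n) ℤ (Fin n → ℤ))

theorem intPeriodic_Theta (K : Fin n → ℤ) : IntPeriodic (Theta Ω K) := fun v Z => by
  rw [Theta_eq, Theta_eq, intPeriodic_expChar]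

/-- The periodic entire function `∑ a_x Θ_{N x}` with given coefficients. -/
def thetaSeries : coeffSpace (latticeForm (imPart Ω) N) →ₗ[ℂ] tailPeriodic Ω N M 0 where
  toFun a := ⟨⟨fun Z => ∑' x, a.1 x * Theta Ω (N.equivFun.symm x) Z,
    differentiable_tsum_of_bound
      (fun x => ((differentiable_expChar _).const_mul _).const_mul _)
      (exists_thetaSeries_bound Ω N a)⟩,
    mem_tailPeriodic.2 fun i _ Z => tsum_congr fun x => by rw [intPeriodic_Theta]⟩
  map_add' a a' := Subtype.ext <| Subtype.ext <| funext fun Z => by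
    refine Eq.trans (tsum_congr fun x => ?_)
      ((summable_thetaSeries Ω N a Z).tsum_add (summable_thetaSeries Ω N a' Z))
    exact add_mul _ _ _
  map_smul' c a := Subtype.ext <| Subtype.ext <| funext fun Z => by
    refine Eq.trans (tsum_congr fun x => ?_)
      ((summable_thetaSeries Ω N a Z).tsum_const_smul c)
    exact mul_assoc _ _ _

theorem hasSum_thetaSeries (a : coeffSpace (latticeForm (imPart Ω) N)) (Z : Fin n → ℂ) :
    HasSum (fun x => a.1 x * Theta Ω (N.equivFun.symm x) Z) ((thetaSeries Ω N M a).1.1 Z) :=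
  (summable_thetaSeries Ω N a Z).hasSum

theorem unitAt_self (j : Fin n) : unitAt n j = Pi.single j 1 := by
  funext i
  simp [unitAt, Pi.single_apply, Fin.ext_iff]

/-- The operator `N_j` shifts the coefficients. -/
theorem diffOn_thetaSeries {Ω : Matrix (Fin n) (Fin n) ℂ} (hΩ : Ω.IsSymm)
    (N M : Module.Basis (Fin n) ℤ (Fin n → ℤ)) (j : Fin n)
    (a : coeffSpace (latticeForm (imPart Ω) N)) :
    diffOn hΩ N M 0 (Sum.inlₗ j) (thetaSeries Ω N M a) =
      thetaSeries Ω N M (coeffDiff _ (Sum.inlₗ j : Dir n) a) := by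
  refine Subtype.ext (Subtype.ext (funext fun Z => ?_))
  have h0 : toC (0 : Fin n → ℤ) = 0 := by funext i; simp [toC]
  have h1 : (diffOn hΩ N M 0 (Sum.inlₗ j) (thetaSeries Ω N M a)).1.1 Z =
      expChar (N j) Z * thetaConst Ω (N j) *
        (thetaSeries Ω N M a).1.1 (Z + toC 0 + Ω *ᵥ toC (N j)) -
      (thetaSeries Ω N M a).1.1 Z := rfl
  rw [h1, h0, add_zero]
  have h2 := (hasSum_thetaSeries Ω N M a (Z + Ω *ᵥ toC (N j))).mul_left
    (expChar (N j) Z * thetaConst Ω (N j))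
  have hj : N.equivFun.symm (Pi.single j 1) = N j := by
    rw [LinearEquiv.symm_apply_eq]
    funext i
    rw [N.equivFun_self, Pi.single_apply]
    simp only [eq_comm]
  have h3 : ∀ x, expChar (N j) Z * thetaConst Ω (N j) *
      (a.1 x * Theta Ω (N.equivFun.symm x) (Z + Ω *ᵥ toC (N j))) =
      a.1 ((x + unitAt n j) - unitAt n j) * Theta Ω (N.equivFun.symm (x + unitAt n j)) Z :=
    fun x => by
      rw [add_sub_cancel_right, map_add, unitAt_self, hj,
        ← Theta_add hΩ]
      ring
  simp only [h3] at h2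
  have h4 := (Equiv.addRight (unitAt n j)).hasSum_iff
    (f := fun x => a.1 (x - unitAt n j) * Theta Ω (N.equivFun.symm x) Z) |>.1 h2
  have h5 := h4.sub (hasSum_thetaSeries Ω N M a Z)
  have h6 := hasSum_thetaSeries Ω N M (coeffDiff _ (Sum.inlₗ j : Dir n) a) Z
  simp only [coeffDiff_inl_apply, sub_mul] at h6
  exact h5.unique h6

theorem intPeriodic_of_tailPeriodic {f : Entire n} (hf : f ∈ tailPeriodic Ω N M 0) :
    IntPeriodic f.1 := by
  let P : AddSubgroup (Fin n → ℤ) :=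
    { carrier := {v | ∀ Z, f.1 (Z + toC v) = f.1 Z}
      zero_mem' := fun Z => by
        have h0 : toC (0 : Fin n → ℤ) = 0 := by funext i; simp [toC]
        rw [h0, add_zero]
      add_mem' := fun {v w} hv hw Z => by
        rw [toC_add, ← add_assoc, hw, hv]
      neg_mem' := fun {v} hv Z => by
        rw [← hv (Z + toC (-v)), toC_neg, neg_add_cancel_right] }
  have hP : ⊤ ≤ AddSubgroup.toIntSubmodule P := by
    rw [← M.span_eq, Submodule.span_le]
    rintro _ ⟨i, rfl⟩
    exact mem_tailPeriodic.1 hf i (Nat.zero_le _)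
  exact fun v => hP (Submodule.mem_top (x := v))

theorem thetaConst_ne_zero (K : Fin n → ℤ) : thetaConst Ω K ≠ 0 := Complex.exp_ne_zero _

theorem thetaSeries_injective : Function.Injective (thetaSeries Ω N M) := by
  rw [injective_iff_map_eq_zero]
  intro a ha
  let c : (Fin n → ℤ) → ℂ := fun K => a.1 (N.equivFun K) * thetaConst Ω K
  have hcx : ∀ x, c (N.equivFun.symm x) = a.1 x * thetaConst Ω (N.equivFun.symm x) := fun x => by
    simp only [c, LinearEquiv.apply_symm_apply]
  have hc : Summable fun K => ‖c K‖ := by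
    rw [← N.equivFun.symm.toEquiv.summable_iff]
    obtain ⟨C, hC⟩ := (mem_coeffSpace_latticeForm Ω N).1 a.2 1
    refine Summable.of_norm_bounded (summable_exp_neg_norm₁.mul_left C) fun x => ?_
    rw [Function.comp_apply, norm_norm, LinearEquiv.coe_toEquiv, hcx]
    simpa only [one_mul] using hC x
  have hsum : ∀ x : Fin n → ℝ, HasSum (fun K => c K * expChar K (ofRealVec x)) 0 := fun x => by
    have h := hasSum_thetaSeries Ω N M a (ofRealVec x)
    rw [ha] at h
    rw [← N.equivFun.symm.toEquiv.hasSum_iff]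
    refine h.congr_fun ?_
    intro y
    rw [Function.comp_apply, LinearEquiv.coe_toEquiv, hcx, Theta_eq, mul_assoc]
  refine Subtype.ext (funext fun x => ?_)
  have h := eq_zero_of_hasSum_expChar hc hsum (N.equivFun.symm x)
  rw [hcx] at h
  exact (mul_eq_zero.1 h).resolve_right (thetaConst_ne_zero _ _)

theorem thetaSeries_surjective : Function.Surjective (thetaSeries Ω N M) := by
  intro f
  have hper := intPeriodic_of_tailPeriodic Ω N M f.2
  have hmem : (fun x => fourierMean f.1.1 (N.equivFun.symm x) /
      thetaConst Ω (N.equivFun.symm x)) ∈ coeffSpace (latticeForm (imPart Ω) N) := by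
    rw [mem_coeffSpace_latticeForm]
    intro R
    obtain ⟨L, hL0, hL⟩ := exists_norm₁_map_le N.equivFun.toLinearMap
    obtain ⟨C, hC0, hC⟩ := fourierMean_bound hper f.1.2 (mul_nonneg (abs_nonneg R) hL0)
    refine ⟨C, fun x => ?_⟩
    rw [div_mul_cancel₀ _ (thetaConst_ne_zero _ _)]
    refine (hC _).trans (mul_le_mul_of_nonneg_left (Real.exp_le_exp.2 (neg_le_neg ?_)) hC0)
    have h1 : norm₁ x ≤ L * norm₁ (N.equivFun.symm x) := by
      have h := hL (N.equivFun.symm x)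
      rwa [LinearEquiv.coe_coe, LinearEquiv.apply_symm_apply] at h
    have h2 := mul_le_mul_of_nonneg_left h1 (abs_nonneg R)
    have h3 := mul_le_mul_of_nonneg_right (le_abs_self R) (norm₁_nonneg x)
    have h4 : 0 ≤ |R| * (L * norm₁ (N.equivFun.symm x)) :=
      mul_nonneg (abs_nonneg R) (mul_nonneg hL0 (norm₁_nonneg _))
    have h5 : 1 * (|R| * (L * norm₁ (N.equivFun.symm x))) ≤
        2 * Real.pi * (|R| * (L * norm₁ (N.equivFun.symm x))) :=
      mul_le_mul_of_nonneg_right (by linarith [Real.pi_gt_three]) h4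
    linarith
  refine ⟨⟨_, hmem⟩, Subtype.ext (Subtype.ext (funext fun Z => ?_))⟩
  have h1 := hasSum_thetaSeries Ω N M ⟨_, hmem⟩ Z
  have h2 := hasSum_fourierMean hper f.1.2 Z
  rw [← N.equivFun.symm.toEquiv.hasSum_iff] at h2
  refine h1.unique (h2.congr_fun ?_)
  intro x
  simp only [Theta_eq, ← mul_assoc, div_mul_cancel₀ _ (thetaConst_ne_zero _ _)]
  rfl

theorem hasSum_gammaPlus (k : ℕ) {a : coeffSpace (latticeForm (imPart Ω) N)}
    (ha : ∀ x, a.1 x = tailIndicator n k x) (Z : Fin n → ℂ) :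
    HasSum (fun K : GammaPlus k N => Theta Ω (K : Fin n → ℤ) Z)
      ((thetaSeries Ω N M a).1.1 Z) := by
  have hmem : ∀ x, N.equivFun.symm x ∈ (GammaPlus k N : Set (Fin n → ℤ)) ↔
      ∀ i : Fin n, (i : ℕ) < k → x i = 0 := fun x => by
    have h1 : ∀ i, N.repr (N.equivFun.symm x) i = x i := fun i =>
      congrFun (N.equivFun.apply_symm_apply x) i
    rw [SetLike.mem_coe, GammaPlus, Module.Basis.mem_span_image]
    constructor
    · intro h i hi
      by_contra h0
      have : i ∈ (N.repr (N.equivFun.symm x)).support := by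
        rw [Finsupp.mem_support_iff, h1]
        exact h0
      exact absurd (h this) (not_le.2 hi)
    · intro h i hi
      rw [Finset.mem_coe, Finsupp.mem_support_iff, h1] at hi
      exact not_lt.1 fun h' => hi (h i h')
  have h := hasSum_thetaSeries Ω N M a Z
  refine (hasSum_subtype_iff_indicator (s := (GammaPlus k N : Set (Fin n → ℤ)))
    (f := fun K => Theta Ω K Z)).2 ?_
  rw [← N.equivFun.symm.toEquiv.hasSum_iff]
  refine h.congr_fun ?_
  intro x
  rw [ha, tailIndicator]
  by_cases hx : ∀ i : Fin n, (i : ℕ) < k → x i = 0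
  · rw [if_pos hx, one_mul]
    exact Set.indicator_of_mem ((hmem x).2 hx) _
  · rw [if_neg hx, zero_mul]
    exact Set.indicator_of_notMem (fun h => hx ((hmem x).1 h)) _

end ThetaSeries

/-! ### The cocycle -/

section Main

/-- A cochain concentrated at `S₀` is a cocycle if all other operators annihilate its value. -/
theorem koszulD_single_eq_zero {ι : Type*} [LinearOrder ι] {A : Type*} [AddCommGroup A]
    [Module ℂ A] {D : ι → A →ₗ[ℂ] A} {S₀ : Finset ι} {a : A} (h : ∀ p ∉ S₀, D p a = 0) :
    koszulD D (Pi.single S₀ a) = 0 := by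
  funext S
  rw [koszulD_apply]
  refine Finset.sum_eq_zero fun p _ => ?_
  by_cases hp : S.erase p = S₀
  · rw [hp, Pi.single_eq_same, h p (hp ▸ Finset.notMem_erase p S), smul_zero]
  · rw [Pi.single_eq_of_ne hp, map_zero, smul_zero]

variable {n : ℕ}

/-- The indicator function of the positive directions is annihilated by the difference operators in
these directions. -/
theorem coeffDiff_eq_zero_of_le {k : ℕ} {b : LinearMap.BilinForm ℝ (Fin n → ℝ)} {a : coeffSpace b}
    (ha : ∀ x, a.1 x = tailIndicator n k x) {j : Fin n} (hj : k ≤ (j : ℕ)) :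
    coeffDiff b (Sum.inlₗ j : Dir n) a = 0 := by
  refine Subtype.ext (funext fun x => ?_)
  have h : ∀ i : Fin n, (i : ℕ) < k → unitAt n j i = 0 := fun i hi =>
    if_neg (hi.trans_le hj).ne
  have h2 : tailIndicator n k (x - unitAt n j) = tailIndicator n k x := by
    have h3 : (∀ i : Fin n, (i : ℕ) < k → (x - unitAt n j) i = 0) ↔
        ∀ i : Fin n, (i : ℕ) < k → x i = 0 :=
      forall₂_congr fun i hi => by rw [Pi.sub_apply, h i hi, sub_zero]
    simp only [tailIndicator, h3]
  rw [coeffDiff_inl_apply, ha, ha, h2, sub_self]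
  rfl

end Main

end ThetaForms

end

theorem theorem3p2 (n k : ℕ) (Ω : Matrix (Fin n) (Fin n) ℂ)
    (hΩ : ThetaForms.IsPeriodMatrix k Ω)
    (N M : Module.Basis (Fin n) ℤ (Fin n → ℤ))
    (hNM : ThetaForms.IsSplit k (ThetaForms.imPart Ω) N M) :
    (∀ i : ℤ, i ≠ (k : ℤ) →
      Subsingleton (ThetaForms.KoszulCohomology (ThetaForms.diff Ω N M) i)) ∧
    Nonempty (ThetaForms.KoszulCohomology (ThetaForms.diff Ω N M) (k : ℤ) ≃ₗ[ℂ] ℂ) ∧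
    ∃ θ : ThetaForms.Entire n,
      (∀ Z : Fin n → ℂ,
        HasSum (fun K : ThetaForms.GammaPlus k N =>
          ThetaForms.Theta Ω (K : Fin n → ℤ) Z) ((θ : (Fin n → ℂ) → ℂ) Z)) ∧
      ∃ hc : ThetaForms.cochainAt k θ ∈
          ThetaForms.koszulCocycles (ThetaForms.diff Ω N M) (k : ℤ),
        Submodule.span ℂ
          {(Submodule.Quotient.mk ⟨ThetaForms.cochainAt k θ, hc⟩ :
            ThetaForms.KoszulCohomology (ThetaForms.diff Ω N M) (k : ℤ))} = ⊤ := by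
  open ThetaForms in
  have hk : k ≤ n := by
    rw [← hΩ.index]
    exact (Finset.card_filter_le _ _).trans_eq (by simp)
  have hcard : (topIndex n k).card = k := card_topIndex hk
  obtain ⟨a, ha, hline⟩ := koszulLine_coeffDiff (n := n) k n le_rfl _
    (isSplitForm_latticeForm (imPart_isHermitian hΩ.symm) hΩ.index hNM.pos_left)
  rw [min_eq_left hk] at hline
  have hdir : ∀ q ∈ topIndex n n, ∃ j : Fin n, q = Sum.inlₗ j := fun q hq => by
    simpa [topIndex] using hq
  let e := LinearEquiv.ofBijective (thetaSeries Ω N M)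
    ⟨thetaSeries_injective Ω N M, thetaSeries_surjective Ω N M⟩
  have he : ∀ q ∈ topIndex n n, ∀ a, diffOn hΩ.symm N M 0 q (e a) = e (coeffDiff _ q a) := by
    intro q hq a
    obtain ⟨j, rfl⟩ := hdir q hq
    exact diffOn_thetaSeries hΩ.symm N M j a
  have hline' := (hline.of_equiv e he).of_tailPeriodic hΩ.symm N M (topIndex_mono hk)
  set θ : Entire n := (thetaSeries Ω N M a).1 with hθ
  replace hline' : KoszulLine (diff Ω N M) Finset.univ (topIndex n k) θ := hline'
  have hcoc : Pi.single (topIndex n k) θ ∈ koszulCocycles (diff Ω N M) (k : ℤ) := by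
    refine ⟨fun S hS => Pi.single_eq_of_ne (fun h => hS (by rw [h, hcard])) _,
      koszulD_single_eq_zero fun p hp => ?_⟩
    obtain ⟨j | i, rfl⟩ := toLex.surjective p
    · have hj : k ≤ (j : ℕ) := not_lt.1 fun hj => hp (by
        simp only [topIndex, Finset.mem_filter, Finset.mem_univ, true_and]
        exact ⟨j, hj, rfl⟩)
      have h := diffOn_thetaSeries hΩ.symm N M j a
      rw [coeffDiff_eq_zero_of_le ha hj, map_zero] at h
      exact congrArg Subtype.val h
    · exact (thetaSeries Ω N M a).2 i (Nat.zero_le _)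
  have hcard' : (k : ℤ) = (topIndex n k).card := by rw [hcard]
  exact ⟨fun i hi => hline'.subsingleton (hcard' ▸ hi), hline'.nonempty_equiv hcard' hcoc, θ,
    hasSum_gammaPlus Ω N M k ha, hcoc, hline'.span_eq_top hcard' hcoc⟩
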